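/- Let $n\ge 1$ and $\lambda\ge 2$ be integers and $\Lambda=\{0,\dots,\lambda-1\}^n$. A trigonometric polynomial is a function $f(\xi)=\sum_{k\in\mathbb Z^n}h(k)e^{-ik\cdot\xi}$ on $\mathbb R^n$ with only finitely many nonzero coefficients $h(k)\in\mathbb C$, and the Fourier transform on $L^2(\mathbb R^n)$ is normalized by $\widehat f(\xi)=\int_{\mathbb R^n} f(x)e^{-ix\cdot\xi}\,dx$ for $f\in L^1\cap L^2$. Let $0\le N\le\lambda^n$. For each $1\le l\le N$ let $r_l\ge 0$ be an integer and let $p_l$ and $g_l^{(r)}$, $1\le r\le r_l$, be trigonometric polynomials with $p_l(0)=1$ and $$1-|p_l(\xi)|^2=\lambda^n\sum_{r=1}^{r_l}|g_l^{(r)}(\xi)|^2\qquad\text{for all }\xi .$$ For $N<l\le\lambda^n$ let $p_l$ be a trigonometric polynomial with $|p_l|^2= 1$. Let $\nu_1,\dots,\nu_{\lambda^n}$ be the distinct elements of $\Lambda$ in some order, put $$\tau(\xi)=\lambda^{-n}\sum_{l=1}^{\lambda^n}p_l(\lambda\xi)e^{i\nu_l\cdot\xi},$$ and assume $\tau(0)=1$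 (equivalently, $p_l(0)=1$ also for $N<l\le\lambda^n$). Define $$q_{1,l}^{(r)}(\xi)=\tau(\xi)\overline{g_l^{(r)}(\lambda\xi)}\quad(1\le l\le N,\ 1\le r\le r_l),\qquad q_{2,m}(\xi)=\lambda^{-n/2}\bigl(e^{i\nu_m\cdot\xi}-\tau(\xi)\overline{p_m(\lambda\xi)}\bigr)\quad(1\le m\le\lambda^n).$$ Write $q_1,\dots,q_L$, $L=\sum_{l=1}^N r_l+\lambda^n$, for all these functions. Then $\tau,q_1,\dots,q_L$ are trigonometric polynomials satisfying $$\tau(\xi)\overline{\tau(\xi+\gamma)}+\sum_{i=1}^{L}q_i(\xi)\overline{q_i(\xi+\gamma)}=\begin{cases}1,&\gamma=0,\\0,&\gamma\ne0,\end{cases}\qquad \xi\in\mathbb R^n,\ \gamma\in\tfrac{2\pi}{\lambda}\Lambda ;$$ there is $\phi_\tau\in L^2(\mathbb R^n)$ with $\widehat{\phi_\tau}(\xi)=\prod_{j=1}^\infty\tau(\lambda^{-j}\xi)$ (the product converging) and $\widehat{\phi_\tau}(\lambda\xi)=\tau(\xi)\widehat{\phi_\tau}(\xi)$ for almost every $\xi$;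 and the functions $\psi^{(i)}$ defined by $\widehat{\psi^{(i)}}(\lambda\xi)=q_i(\xi)\widehat{\phi_\tau}(\xi)$, $1\le i\le L$, belong to $L^2(\mathbb R^n)$, are compactly supported, and generate a tight wavelet frame of $L^2(\mathbb R^n)$: with $\psi^{(i)}_{j,k}(x)=\lambda^{jn/2}\psi^{(i)}(\lambda^jx-k)$, $$\sum_{i=1}^{L}\sum_{j\in\mathbb Z}\sum_{k\in\mathbb Z^n}\bigl|\langle f,\psi^{(i)}_{j,k}\rangle\bigr|^2=\|f\|_{L^2(\mathbb R^n)}^2\qquad\text{for all } f\in L^2(\mathbb R^n).$$ -/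

import Mathlib

open MeasureTheory FourierTransform

namespace TWF

/-- `ℝⁿ` with the Euclidean norm. -/
abbrev Rn (n : ℕ) : Type := EuclideanSpace ℝ (Fin n)

/-- `L²(ℝⁿ)`, complex valued, with respect to Lebesgue measure. -/
abbrev L2 (n : ℕ) : Type := Lp (α := Rn n) ℂ 2 volume

/-- The integer vector `k ∈ ℤⁿ` as a point of `ℝⁿ`. -/
def intVec {n : ℕ} (k : Fin n → ℤ) : Rn n := WithLp.toLp 2 fun i => (k i : ℝ)

/-- The exponential `ξ ↦ e^{i k · ξ}`, where `k ∈ ℤⁿ`. -/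
noncomputable def cexpInt {n : ℕ} (k : Fin n → ℤ) (ξ : Rn n) : ℂ :=
  Complex.exp (Complex.I * ((∑ i, (k i : ℝ) * ξ i : ℝ) : ℂ))

/-- `f` is a trigonometric polynomial: `f(ξ) = ∑ₖ h(k) e^{-i k · ξ}` with a finitely supported
family of complex coefficients `h(k)`, `k ∈ ℤⁿ`. -/
def IsTrigPoly {n : ℕ} (f : Rn n → ℂ) : Prop :=
  ∃ h : (Fin n → ℤ) →₀ ℂ, ∀ ξ, f ξ = ∑ k ∈ h.support, h k * cexpInt (-k) ξ

/-- The digit set `Λ = {0, …, lam - 1}ⁿ`. -/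
noncomputable def digits (lam n : ℕ) : Finset (Fin n → ℤ) :=
  Fintype.piFinset fun _ => Finset.Ico (0 : ℤ) lam

/-- The Fourier transform on `L²(ℝⁿ)`, normalized so that it is
`f̂(ξ) = ∫ f(x) e^{-i x · ξ} dx` on `L¹ ∩ L²`. Mathlib's `𝓕` has the kernel `e^{-2πi x · ξ}`,
so `f̂(ξ) = (𝓕 f)(ξ / 2π)`. It is meaningful up to a null set. -/
noncomputable def ft {n : ℕ} (f : L2 n) (ξ : Rn n) : ℂ :=
  ((𝓕 f : L2 n) : Rn n → ℂ) ((2 * Real.pi)⁻¹ • ξ)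

/-- `φ ∈ L²(ℝⁿ)` is refinable with refinement mask `τ`: `φ̂(lam ξ) = τ(ξ) φ̂(ξ)`. -/
def IsRefinable {n : ℕ} (lam : ℕ) (τ : Rn n → ℂ) (φ : L2 n) : Prop :=
  ∀ᵐ ξ : Rn n, ft φ ((lam : ℝ) • ξ) = τ ξ * ft φ ξ

/-- `φ` is the function `φ_τ ∈ L²(ℝⁿ)` with `φ̂_τ(ξ) = ∏_{j ≥ 1} τ(lam^{-j} ξ)`, where the
infinite product converges (unconditionally). Here `j` is shifted to start at `0`. -/
def IsPhi {n : ℕ} (lam : ℕ) (τ : Rn n → ℂ) (φ : L2 n) : Prop :=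
  ∀ᵐ ξ : Rn n, HasProd (fun j : ℕ => τ (((lam : ℝ) ^ (j + 1))⁻¹ • ξ)) (ft φ ξ)

/-- The unitary extension principle condition: for all `ξ` and all
`γ ∈ Γ = (2π / lam) · {0, …, lam - 1}ⁿ`,
`τ(ξ) conj τ(ξ + γ) + ∑ₗ qₗ(ξ) conj qₗ(ξ + γ)` equals `1` if `γ = 0` and `0` otherwise. -/
def UEP {n : ℕ} (lam : ℕ) {ι : Type} [Fintype ι] (τ : Rn n → ℂ) (q : ι → Rn n → ℂ) : Prop :=
  ∀ ξ : Rn n, ∀ μ ∈ digits lam n,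
    τ ξ * star (τ (ξ + (2 * Real.pi / lam) • intVec μ)) +
      ∑ l, q l ξ * star (q l (ξ + (2 * Real.pi / lam) • intVec μ)) = if μ = 0 then 1 else 0

/-- `(τ, q)` is a combined MRA mask: `τ` and the `qₗ` are trigonometric polynomials,
`τ(0) = 1`, the refinable function `φ_τ` exists in `L²(ℝⁿ)`, has refinement mask `τ`, and the
UEP condition holds, i.e. the `qₗ` are wavelet masks. -/
structure IsCombinedMRAMask {n : ℕ} (lam : ℕ) {ι : Type} [Fintype ι] (τ : Rn n → ℂ)
    (q : ι → Rn n → ℂ) : Prop where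
  trigPoly_refinementMask : IsTrigPoly τ
  refinementMask_zero : τ 0 = 1
  trigPoly_waveletMask : ∀ l, IsTrigPoly (q l)
  exists_phi : ∃ φ : L2 n, IsPhi lam τ φ ∧ IsRefinable lam τ φ
  uep : UEP lam τ q

/-- `ψ = (ψ⁽ˡ⁾)` are the mother wavelets of the wavelet system `X(τ, q)`:
`ψ̂⁽ˡ⁾(lam ξ) = qₗ(ξ) φ̂_τ(ξ)`. Since the Fourier transform is injective on `L²(ℝⁿ)`,
these conditions determine `φ_τ` and `ψ`. -/
def AreMotherWavelets {n : ℕ} (lam : ℕ) {ι : Type} (τ : Rn n → ℂ) (q : ι → Rn n → ℂ)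
    (ψ : ι → L2 n) : Prop :=
  ∃ φ : L2 n, IsPhi lam τ φ ∧
    ∀ l, ∀ᵐ ξ : Rn n, ft (ψ l) ((lam : ℝ) • ξ) = q l ξ * ft φ ξ

/-- `ψ_{j,k}(x) = lam^{jn/2} ψ(lam^j x - k)`. -/
noncomputable def dilTrans {n : ℕ} (lam : ℕ) (j : ℤ) (k : Fin n → ℤ) (ψ : Rn n → ℂ)
    (x : Rn n) : ℂ :=
  (((lam : ℝ) ^ ((j : ℝ) * n / 2) : ℝ) : ℂ) * ψ (((lam : ℝ) ^ j) • x - intVec k)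

/-- The wavelet system generated by the finite family `ψ` is a tight frame of `L²(ℝⁿ)`:
`∑_l ∑_{j,k} |⟨f, ψ⁽ˡ⁾_{j,k}⟩|² = ‖f‖²` for all `f ∈ L²(ℝⁿ)`. -/
def IsTightFrame {n : ℕ} (lam : ℕ) {ι : Type} (ψ : ι → L2 n) : Prop :=
  ∀ f : L2 n,
    HasSum (fun a : ι × ℤ × (Fin n → ℤ) =>
        ‖∫ x : Rn n, f x * star (dilTrans lam a.2.1 a.2.2 (ψ a.1) x)‖ ^ 2) (‖f‖ ^ 2)

/-- `f` vanishes almost everywhere outside a compact set. -/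
def IsCompactlySupported {n : ℕ} (f : L2 n) : Prop :=
  ∃ K : Set (Rn n), IsCompact K ∧ ∀ᵐ x : Rn n, x ∉ K → f x = 0

/-- The refinement mask `τ(ξ) = lam^{-n} ∑ₗ pₗ(lam ξ) e^{i νₗ · ξ}`. -/
noncomputable def refMask {n : ℕ} (lam : ℕ) (ν : Fin (lam ^ n) → Fin n → ℤ)
    (p : Fin (lam ^ n) → Rn n → ℂ) (ξ : Rn n) : ℂ :=
  ((lam : ℂ) ^ n)⁻¹ * ∑ l, p l ((lam : ℝ) • ξ) * cexpInt (ν l) ξ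

/-- The masks `q_{1,l}^{(s)}(ξ) = τ(ξ) conj g_l^{(s)}(lam ξ)` and
`q_{2,m}(ξ) = lam^{-n/2} (e^{i ν_m · ξ} - τ(ξ) conj p_m(lam ξ))`. -/
noncomputable def waveletMask {n : ℕ} (lam : ℕ) (ν : Fin (lam ^ n) → Fin n → ℤ)
    (p : Fin (lam ^ n) → Rn n → ℂ) {N : ℕ} {r : Fin N → ℕ}
    (g : (l : Fin N) → Fin (r l) → Rn n → ℂ) :
    ((l : Fin N) × Fin (r l)) ⊕ Fin (lam ^ n) → Rn n → ℂ
  | Sum.inl ⟨l, s⟩, ξ => refMask lam ν p ξ * star (g l s ((lam : ℝ) • ξ))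
  | Sum.inr m, ξ => (((lam : ℝ) ^ (-(n : ℝ) / 2) : ℝ) : ℂ) *
      (cexpInt (ν m) ξ - refMask lam ν p ξ * star (p m ((lam : ℝ) • ξ)))

end TWF

/-!
The statement is the unitary extension principle, applied to an explicit family of masks.

*The masks.* With `γ = 2πμ / lam`, the functions `p l (lam •)` and `g l s (lam •)` are invariant
under the translation by `γ`, and the digits `ν l` run through a complete system of residues modulo
`lam`, so that `∑ₗ e^{-i νₗ γ}` vanishes unless `γ = 0`. Expanding the products, everything that
involves `p` and `g` cancels (`uep_waveletMask`).

*The refinable function.* The principle says that the matrix with entries `q_o(ξ + γ)`, the row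
index being `γ` and `τ` being counted among the `q_o`, satisfies `M Mᴴ = 1`. Hence its `τ`-column
has norm at most `1` (`UEP.sum_digits_norm_sq_le`), and iterating this over the partial products
gives `∑ₖ |φ̂(ξ + 2πk)|² ≤ 1` (`sum_norm_sq_phiHat_le`), so the infinite product is square
integrable. Its partial products are exponential sums with frequencies in a fixed ball, i.e. Fourier
transforms of finitely supported complex measures on that ball with integral `1`, and they converge
boundedly. Therefore
`φ` is supported in the ball and has integral `1` (`refinable_ae_eq_zero`, `integral_refinable`).
No Paley–Wiener theorem is needed.

*The frame identity.* A mask `∑ h(m) e^{-i m ξ}` acts on `φ` as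
`x ↦ lamⁿ ∑ h(m) φ(lam x - m)` (`ft_filterL2`), so the coefficients of `f` at scale `j` are filtered
versions of the coefficients `⟨f, φ_{j+1,k}⟩`. Comparing Fourier coefficients in the unitary
extension principle shows that this filtering preserves the energy (`hasSum_norm_sq_filter`):
`∑ₖ |⟨f, φ_{j+1,k}⟩|² = ∑ₖ |⟨f, φ_{j,k}⟩|² + ∑ᵢ ∑ₖ |⟨f, ψⁱ_{j,k}⟩|²`. It remains to sum over `j`:
the energies `∑ₖ |⟨f, φ_{j,k}⟩|²` tend to `‖f‖²` as `j → ∞` and to `0` as `j → -∞`. By Bessel's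
inequality (`tsum_enorm_sq_waveCoeff_le`) both limits need to be checked only for continuous
functions with compact support (`tendsto_tsum_waveCoeff_atTop`, `tendsto_tsum_waveCoeff_atBot`).
-/

namespace TWF

variable {n : ℕ}

/-! ### Integer exponentials -/

lemma cexpInt_add (k l : Fin n → ℤ) (ξ : Rn n) :
    cexpInt (k + l) ξ = cexpInt k ξ * cexpInt l ξ := by
  simp only [cexpInt, ← Complex.exp_add]
  congr 1
  push_cast
  simp only [Pi.add_apply, Int.cast_add, add_mul, Finset.sum_add_distrib, mul_add]

lemma cexpInt_zero (ξ : Rn n) : cexpInt (0 : Fin n → ℤ) ξ = 1 := by simp [cexpInt]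

lemma cexpInt_apply_zero (k : Fin n → ℤ) : cexpInt k 0 = 1 := by simp [cexpInt]

lemma cexpInt_apply_add (k : Fin n → ℤ) (ξ η : Rn n) :
    cexpInt k (ξ + η) = cexpInt k ξ * cexpInt k η := by
  simp only [cexpInt, ← Complex.exp_add]
  congr 1
  push_cast
  simp only [PiLp.add_apply, Complex.ofReal_add, mul_add, Finset.sum_add_distrib]

lemma star_cexpInt (k : Fin n → ℤ) (ξ : Rn n) : star (cexpInt k ξ) = cexpInt (-k) ξ := by
  simp only [cexpInt, Complex.star_def, ← Complex.exp_conj]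
  congr 1
  simp

lemma norm_cexpInt (k : Fin n → ℤ) (ξ : Rn n) : ‖cexpInt k ξ‖ = 1 := by
  rw [cexpInt, mul_comm, Complex.norm_exp_ofReal_mul_I]

lemma cexpInt_neg_mul_self (k : Fin n → ℤ) (ξ : Rn n) : cexpInt (-k) ξ * cexpInt k ξ = 1 := by
  rw [← cexpInt_add, neg_add_cancel, cexpInt_zero]

lemma cexpInt_apply_smul (lam : ℕ) (k : Fin n → ℤ) (ξ : Rn n) :
    cexpInt k ((lam : ℝ) • ξ) = cexpInt ((lam : ℤ) • k) ξ := by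
  simp only [cexpInt]
  congr 3
  refine Finset.sum_congr rfl fun i _ => ?_
  simp
  ring

lemma cexpInt_two_pi (k m : Fin n → ℤ) : cexpInt k ((2 * Real.pi) • intVec m) = 1 := by
  rw [cexpInt, Complex.exp_eq_one_iff]
  refine ⟨∑ i, k i * m i, ?_⟩
  push_cast
  rw [Finset.mul_sum, Finset.sum_mul]
  refine Finset.sum_congr rfl fun i _ => ?_
  simp [intVec]
  ring

lemma continuous_cexpInt (k : Fin n → ℤ) : Continuous (cexpInt k) := by
  unfold cexpInt
  fun_prop

lemma intVec_add (k l : Fin n → ℤ) : intVec (k + l) = intVec k + intVec l := by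
  ext i; simp [intVec]

lemma intVec_zero : intVec (0 : Fin n → ℤ) = 0 := by ext i; simp [intVec]

lemma intVec_natCast_smul (lam : ℕ) (k : Fin n → ℤ) :
    intVec ((lam : ℤ) • k) = (lam : ℝ) • intVec k := by
  ext i; simp [intVec]

/-- `k · ξ` as an inner product. -/
lemma cexpInt_eq_exp_inner (k : Fin n → ℤ) (ξ : Rn n) :
    cexpInt k ξ = Complex.exp (Complex.I * ((inner ℝ (intVec k) ξ : ℝ) : ℂ)) := by
  simp only [cexpInt, intVec, PiLp.inner_apply]
  congr 3
  refine Finset.sum_congr rfl fun i _ => ?_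
  simp [mul_comm]

/-- Distinct integer vectors give distinct exponentials. -/
lemma cexpInt_injective : Function.Injective (cexpInt : (Fin n → ℤ) → Rn n → ℂ) := by
  intro k l h
  by_contra hne
  obtain ⟨i, hi⟩ : ∃ i, k i ≠ l i := Function.ne_iff.mp hne
  have hd : ((k i : ℝ) - l i) ≠ 0 := sub_ne_zero.mpr (by exact_mod_cast hi)
  set ξ : Rn n := EuclideanSpace.single i (Real.pi / ((k i : ℝ) - l i)) with hξ
  have h1 : cexpInt (k + -l) ξ = 1 := by
    rw [cexpInt_add, congrFun h ξ, mul_comm, cexpInt_neg_mul_self]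
  have h2 : cexpInt (k + -l) ξ = -1 := by
    rw [cexpInt, ← Complex.exp_pi_mul_I, mul_comm]
    congr 2
    rw [Finset.sum_eq_single i]
    · have hd' : ((k i : ℂ) - l i) ≠ 0 := by exact_mod_cast hd
      simp [hξ]
      field_simp
      ring
    · intro j _ hj
      simp [hξ, hj]
    · simp
  rw [h1] at h2
  norm_num at h2

/-- The exponentials are linearly independent, being distinct characters of `ℝⁿ`. -/
lemma linearIndependent_cexpInt :
    LinearIndependent ℂ (cexpInt : (Fin n → ℤ) → Rn n → ℂ) := by
  let χ : (Fin n → ℤ) → (Multiplicative (Rn n) →* ℂ) := fun k =>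
    { toFun := fun ξ => cexpInt k ξ.toAdd
      map_one' := cexpInt_apply_zero k
      map_mul' := fun ξ η => cexpInt_apply_add k _ _ }
  have hχ : Function.Injective χ := fun k l h =>
    cexpInt_injective (funext fun ξ => DFunLike.congr_fun h (Multiplicative.ofAdd ξ))
  exact (linearIndependent_monoidHom (Multiplicative (Rn n)) ℂ).comp χ hχ

/-! ### Trigonometric polynomials -/

lemma isTrigPoly_iff_mem_span {f : Rn n → ℂ} :
    IsTrigPoly f ↔ f ∈ Submodule.span ℂ (Set.range (cexpInt : (Fin n → ℤ) → Rn n → ℂ)) := by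
  constructor
  · rintro ⟨h, hf⟩
    have : f = ∑ k ∈ h.support, h k • cexpInt (-k) := by
      ext ξ; simp [hf, Finset.sum_apply]
    rw [this]
    exact Submodule.sum_mem _ fun k _ => Submodule.smul_mem _ _ (Submodule.subset_span ⟨_, rfl⟩)
  · intro h
    obtain ⟨c, rfl⟩ := (Finsupp.mem_span_range_iff_exists_finsupp).mp h
    refine ⟨c.embDomain (Equiv.neg _).toEmbedding, fun ξ => ?_⟩
    simp only [Finsupp.sum, Finset.sum_apply, Pi.smul_apply, smul_eq_mul,
      Finsupp.support_embDomain, Finset.sum_map, Equiv.coe_toEmbedding, Equiv.neg_apply, neg_neg]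
    refine Finset.sum_congr rfl fun k _ => ?_
    congr 1
    exact (Finsupp.embDomain_apply_self (Equiv.neg (Fin n → ℤ)).toEmbedding c k).symm

lemma isTrigPoly_cexpInt (k : Fin n → ℤ) : IsTrigPoly (cexpInt k) :=
  isTrigPoly_iff_mem_span.mpr (Submodule.subset_span ⟨k, rfl⟩)

lemma IsTrigPoly.add {f g : Rn n → ℂ} (hf : IsTrigPoly f) (hg : IsTrigPoly g) :
    IsTrigPoly (fun ξ => f ξ + g ξ) := by
  rw [isTrigPoly_iff_mem_span] at *
  exact Submodule.add_mem _ hf hg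

lemma IsTrigPoly.const_mul {f : Rn n → ℂ} (c : ℂ) (hf : IsTrigPoly f) :
    IsTrigPoly (fun ξ => c * f ξ) := by
  rw [isTrigPoly_iff_mem_span] at *
  exact Submodule.smul_mem _ c hf

lemma IsTrigPoly.sub {f g : Rn n → ℂ} (hf : IsTrigPoly f) (hg : IsTrigPoly g) :
    IsTrigPoly (fun ξ => f ξ - g ξ) := by
  simpa [sub_eq_add_neg] using hf.add (hg.const_mul (-1))

lemma isTrigPoly_zero : IsTrigPoly (fun _ : Rn n => (0 : ℂ)) :=
  isTrigPoly_iff_mem_span.mpr (Submodule.zero_mem _)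

lemma IsTrigPoly.sum {κ : Type*} (s : Finset κ) {f : κ → Rn n → ℂ}
    (hf : ∀ i ∈ s, IsTrigPoly (f i)) : IsTrigPoly (fun ξ => ∑ i ∈ s, f i ξ) := by
  have : (fun ξ => ∑ i ∈ s, f i ξ) = ∑ i ∈ s, f i := by ext; simp
  rw [this, isTrigPoly_iff_mem_span]
  exact Submodule.sum_mem _ fun i hi => isTrigPoly_iff_mem_span.mp (hf i hi)

/-- Every trigonometric polynomial satisfies a property which is true of exponentials and stable
under linear combinations. -/
lemma IsTrigPoly.induction {P : (Rn n → ℂ) → Prop} {f : Rn n → ℂ} (hf : IsTrigPoly f)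
    (hexp : ∀ k, P (cexpInt k)) (hzero : P fun _ => 0)
    (hadd : ∀ f g, P f → P g → P fun ξ => f ξ + g ξ)
    (hmul : ∀ (c : ℂ) f, P f → P fun ξ => c * f ξ) : P f := by
  rw [isTrigPoly_iff_mem_span] at hf
  induction hf using Submodule.span_induction with
  | mem x hx => obtain ⟨k, rfl⟩ := hx; exact hexp k
  | zero => exact hzero
  | add x y _ _ hx hy => exact hadd x y hx hy
  | smul c x _ hx => exact hmul c x hx

lemma IsTrigPoly.mul {f g : Rn n → ℂ} (hf : IsTrigPoly f) (hg : IsTrigPoly g) :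
    IsTrigPoly (fun ξ => f ξ * g ξ) := by
  refine hf.induction (P := fun f => IsTrigPoly fun ξ => f ξ * g ξ) (fun k => ?_) ?_ ?_ ?_
  · refine hg.induction (P := fun g => IsTrigPoly fun ξ => cexpInt k ξ * g ξ)
      (fun l => ?_) ?_ ?_ ?_
    · simpa only [← cexpInt_add] using isTrigPoly_cexpInt (k + l)
    · simpa using isTrigPoly_zero
    · intro u v hu hv
      simpa only [mul_add] using hu.add hv
    · intro c u hu
      simpa only [mul_left_comm] using hu.const_mul c
  · simpa using isTrigPoly_zero
  · intro u v hu hv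
    simpa only [add_mul] using hu.add hv
  · intro c u hu
    simpa only [mul_assoc] using hu.const_mul c

lemma IsTrigPoly.star {f : Rn n → ℂ} (hf : IsTrigPoly f) : IsTrigPoly (fun ξ => star (f ξ)) := by
  refine hf.induction (P := fun f => IsTrigPoly fun ξ => Star.star (f ξ)) (fun k => ?_) ?_ ?_ ?_
  · simpa only [star_cexpInt] using isTrigPoly_cexpInt (-k)
  · simpa using isTrigPoly_zero
  · intro u v hu hv
    simpa only [star_add] using hu.add hv
  · intro c u hu
    simpa only [StarMul.star_mul, mul_comm] using hu.const_mul (Star.star c)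

lemma IsTrigPoly.comp_smul {f : Rn n → ℂ} (hf : IsTrigPoly f) (lam : ℕ) :
    IsTrigPoly (fun ξ => f ((lam : ℝ) • ξ)) := by
  refine hf.induction (P := fun f => IsTrigPoly fun ξ => f ((lam : ℝ) • ξ)) (fun k => ?_) ?_ ?_ ?_
  · simpa only [cexpInt_apply_smul] using isTrigPoly_cexpInt ((lam : ℤ) • k)
  · simpa using isTrigPoly_zero
  · intro u v hu hv
    exact hu.add hv
  · intro c u hu
    exact hu.const_mul c

lemma IsTrigPoly.continuous {f : Rn n → ℂ} (hf : IsTrigPoly f) : Continuous f := by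
  refine hf.induction continuous_cexpInt continuous_const (fun _ _ hu hv => hu.add hv)
    fun c _ hu => continuous_const.mul hu

lemma IsTrigPoly.apply_add_two_pi {f : Rn n → ℂ} (hf : IsTrigPoly f) (ξ : Rn n)
    (m : Fin n → ℤ) : f (ξ + (2 * Real.pi) • intVec m) = f ξ := by
  refine hf.induction (P := fun f => f (ξ + (2 * Real.pi) • intVec m) = f ξ) (fun k => ?_) rfl
    (fun u v hu hv => congrArg₂ (· + ·) hu hv) fun c u hu => congrArg (c * ·) hu
  rw [cexpInt_apply_add, cexpInt_two_pi, mul_one]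

/-- Trigonometric polynomials are Lipschitz at the origin. -/
lemma IsTrigPoly.exists_norm_sub_le {f : Rn n → ℂ} (hf : IsTrigPoly f) :
    ∃ C : ℝ, 0 ≤ C ∧ ∀ ξ, ‖f ξ - f 0‖ ≤ C * ‖ξ‖ := by
  refine hf.induction (P := fun f => ∃ C : ℝ, 0 ≤ C ∧ ∀ ξ, ‖f ξ - f 0‖ ≤ C * ‖ξ‖)
    (fun k => ⟨‖(intVec k : Rn n)‖, norm_nonneg _, fun ξ => ?_⟩)
    ⟨0, le_rfl, fun ξ => by simp⟩ ?_ ?_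
  · rw [cexpInt_apply_zero, cexpInt_eq_exp_inner]
    exact (Real.norm_exp_I_mul_ofReal_sub_one_le).trans (norm_inner_le_norm _ _)
  · rintro u v ⟨C, hC, hu⟩ ⟨D, hD, hv⟩
    refine ⟨C + D, by positivity, fun ξ => ?_⟩
    calc ‖u ξ + v ξ - (u 0 + v 0)‖ = ‖(u ξ - u 0) + (v ξ - v 0)‖ := by ring_nf
      _ ≤ _ := norm_add_le _ _
      _ ≤ (C + D) * ‖ξ‖ := by linarith [hu ξ, hv ξ]
  · rintro c u ⟨C, hC, hu⟩
    refine ⟨‖c‖ * C, by positivity, fun ξ => ?_⟩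
    rw [← mul_sub, norm_mul, mul_assoc]
    gcongr
    exact hu ξ

/-! ### Characters of `ℤⁿ / lam ℤⁿ` and the unitary extension principle -/

lemma sum_exp_Ico {lam : ℕ} (hlam : 0 < lam) (m : ℤ) :
    ∑ a ∈ Finset.Ico (0 : ℤ) lam, Complex.exp (Complex.I * (m * (2 * Real.pi / lam * a)))
      = if (lam : ℤ) ∣ m then (lam : ℂ) else 0 := by
  have hl : (lam : ℂ) ≠ 0 := by exact_mod_cast hlam.ne'
  set ζ : ℂ := Complex.exp (Complex.I * (m * (2 * Real.pi / lam))) with hζ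
  have hpow : ∀ a : ℕ, Complex.exp (Complex.I * (m * (2 * Real.pi / lam * (a : ℤ)))) = ζ ^ a := by
    intro a
    rw [hζ, ← Complex.exp_nat_mul]
    congr 1
    push_cast
    ring
  have hsum : ∑ a ∈ Finset.Ico (0 : ℤ) lam,
      Complex.exp (Complex.I * (m * (2 * Real.pi / lam * a))) = ∑ a ∈ Finset.range lam, ζ ^ a := by
    have : Finset.Ico (0 : ℤ) lam = (Finset.range lam).image (fun a : ℕ => (a : ℤ)) := by
      ext x
      simp only [Finset.mem_Ico, Finset.mem_image, Finset.mem_range]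
      constructor
      · rintro ⟨h0, h1⟩
        exact ⟨x.toNat, by omega, by omega⟩
      · rintro ⟨a, ha, rfl⟩
        omega
    rw [this, Finset.sum_image (fun a _ b _ h => by exact_mod_cast h)]
    exact Finset.sum_congr rfl fun a _ => hpow a
  have hone : ζ = 1 ↔ (lam : ℤ) ∣ m := by
    rw [hζ, Complex.exp_eq_one_iff]
    constructor
    · rintro ⟨k, hk⟩
      refine ⟨k, ?_⟩
      have h2 : (2 * Real.pi * Complex.I : ℂ) ≠ 0 := Complex.two_pi_I_ne_zero
      have : (2 * Real.pi * Complex.I : ℂ) * m = (2 * Real.pi * Complex.I) * (lam * k) := by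
        field_simp at hk ⊢
        linear_combination hk
      exact_mod_cast mul_left_cancel₀ h2 this
    · rintro ⟨k, rfl⟩
      refine ⟨k, ?_⟩
      push_cast
      field_simp
  rw [hsum]
  split_ifs with h
  · rw [hone.mpr h]; simp
  · have h1 : ζ ≠ 1 := fun h' => h (hone.mp h')
    have hz : ζ ^ lam = 1 := by
      rw [← hpow, Complex.exp_eq_one_iff]
      refine ⟨m, ?_⟩
      push_cast
      field_simp
    rw [geom_sum_eq h1, hz]
    simp

/-- Orthogonality of the characters of `(ℤ / lam)ⁿ`. -/
lemma sum_digits_cexpInt {lam : ℕ} (hlam : 0 < lam) (m : Fin n → ℤ) :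
    ∑ μ ∈ digits lam n, cexpInt m ((2 * Real.pi / lam) • intVec μ)
      = if ∀ i, (lam : ℤ) ∣ m i then (lam : ℂ) ^ n else 0 := by
  have h1 : ∀ μ : Fin n → ℤ, cexpInt m ((2 * Real.pi / lam) • intVec μ)
      = ∏ i, Complex.exp (Complex.I * (m i * (2 * Real.pi / lam * μ i))) := by
    intro μ
    rw [cexpInt, ← Complex.exp_sum, ← Finset.mul_sum]
    congr 2
    push_cast
    simp [intVec]
  simp_rw [h1, digits]
  rw [← Finset.prod_univ_sum (fun _ => Finset.Ico (0 : ℤ) lam)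
    (fun i a => Complex.exp (Complex.I * (m i * (2 * Real.pi / lam * a))))]
  simp_rw [sum_exp_Ico hlam]
  split_ifs with h
  · simp [h]
  · push Not at h
    obtain ⟨i, hi⟩ := h
    exact Finset.prod_eq_zero (Finset.mem_univ i) (if_neg hi)

lemma cexpInt_smul_intVec_comm (c : ℝ) (k m : Fin n → ℤ) :
    cexpInt k (c • intVec m) = cexpInt m (c • intVec k) := by
  simp only [cexpInt]
  congr 3
  refine Finset.sum_congr rfl fun i _ => ?_
  simp [intVec]
  ring

lemma mem_digits {lam : ℕ} {μ : Fin n → ℤ} : μ ∈ digits lam n ↔ ∀ i, 0 ≤ μ i ∧ μ i < lam := by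
  simp [digits]

lemma zero_mem_digits {lam : ℕ} (hlam : 0 < lam) : (0 : Fin n → ℤ) ∈ digits lam n :=
  mem_digits.mpr fun i => ⟨le_rfl, by simpa using hlam⟩

/-- The remainder of an integer vector modulo `lam`, an element of `digits lam n`. -/
def rem (lam : ℕ) (m : Fin n → ℤ) : Fin n → ℤ := fun i => m i % lam

/-- The quotient of an integer vector in the division with remainder by `lam`. -/
def quo (lam : ℕ) (m : Fin n → ℤ) : Fin n → ℤ := fun i => m i / lam

lemma rem_mem_digits {lam : ℕ} (hlam : 0 < lam) (m : Fin n → ℤ) : rem lam m ∈ digits lam n :=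
  mem_digits.mpr fun i => ⟨Int.emod_nonneg _ (by omega), Int.emod_lt_of_pos _ (by omega)⟩

lemma rem_add_quo (lam : ℕ) (m : Fin n → ℤ) : rem lam m + (lam : ℤ) • quo lam m = m := by
  ext i
  exact Int.emod_add_mul_ediv (m i) lam

lemma quo_add_rem (lam : ℕ) (m : Fin n → ℤ) : (lam : ℤ) • quo lam m + rem lam m = m := by
  rw [add_comm, rem_add_quo]

lemma rem_eq_self {lam : ℕ} {μ : Fin n → ℤ} (hμ : μ ∈ digits lam n) : rem lam μ = μ := by
  ext i
  exact Int.emod_eq_of_lt (mem_digits.mp hμ i).1 (mem_digits.mp hμ i).2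

lemma rem_smul_add (lam : ℕ) (k m : Fin n → ℤ) : rem lam ((lam : ℤ) • k + m) = rem lam m := by
  ext i
  simp [rem]

lemma rem_eq_rem_iff {lam : ℕ} {m m' : Fin n → ℤ} :
    rem lam m = rem lam m' ↔ ∀ i, (lam : ℤ) ∣ (m - m') i := by
  simp only [funext_iff, rem, Pi.sub_apply]
  exact forall_congr' fun i => Int.emod_eq_emod_iff_emod_sub_eq_zero.trans
    Int.dvd_iff_emod_eq_zero.symm

/-- A trigonometric polynomial only sees the class of `m` modulo `lam`. -/
lemma IsTrigPoly.apply_add_rem {lam : ℕ} (hlam : 0 < lam) {f : Rn n → ℂ} (hf : IsTrigPoly f)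
    (ξ : Rn n) (m : Fin n → ℤ) :
    f (ξ + (2 * Real.pi / lam) • intVec (rem lam m)) = f (ξ + (2 * Real.pi / lam) • intVec m) := by
  have hl : (lam : ℝ) ≠ 0 := by exact_mod_cast hlam.ne'
  conv_rhs => rw [← rem_add_quo lam m, intVec_add, intVec_natCast_smul, smul_add, smul_smul,
    div_mul_cancel₀ _ hl, ← add_assoc, hf.apply_add_two_pi]

/-- The refinement mask and the wavelet masks as one family. -/
def allMasks {ι : Type} (τ : Rn n → ℂ) (q : ι → Rn n → ℂ) (o : Option ι) : Rn n → ℂ :=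
  o.elim τ q

lemma isTrigPoly_allMasks {ι : Type} {τ : Rn n → ℂ} {q : ι → Rn n → ℂ} (hτ : IsTrigPoly τ)
    (hq : ∀ i, IsTrigPoly (q i)) (o : Option ι) : IsTrigPoly (allMasks τ q o) := by
  cases o with
  | none => exact hτ
  | some i => exact hq i

/-- The unitary extension principle condition for an arbitrary pair of translates. -/
lemma UEP.sum_mul_star {lam : ℕ} (hlam : 0 < lam) {ι : Type} [Fintype ι] {τ : Rn n → ℂ}
    {q : ι → Rn n → ℂ} (h : UEP lam τ q) (hτ : IsTrigPoly τ) (hq : ∀ i, IsTrigPoly (q i))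
    (ξ : Rn n) (m m' : Fin n → ℤ) :
    ∑ o, allMasks τ q o (ξ + (2 * Real.pi / lam) • intVec m) *
      star (allMasks τ q o (ξ + (2 * Real.pi / lam) • intVec m'))
      = if rem lam m = rem lam m' then 1 else 0 := by
  have key := h (ξ + (2 * Real.pi / lam) • intVec m) (rem lam (m' - m)) (rem_mem_digits hlam _)
  rw [hτ.apply_add_rem hlam] at key
  simp_rw [(hq _).apply_add_rem hlam, add_assoc, ← smul_add, ← intVec_add,
    add_sub_cancel] at key
  rw [Fintype.sum_option]
  refine key.trans ?_
  congr 1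
  rw [eq_comm (a := rem lam m), rem_eq_rem_iff, funext_iff]
  exact propext (forall_congr' fun i => Int.dvd_iff_emod_eq_zero.symm)

/-- The sub-QMF condition, which holds since the columns of a matrix `M` with `M Mᴴ = 1` have norm
at most `1`. -/
lemma UEP.sum_digits_norm_sq_le {lam : ℕ} (hlam : 0 < lam) {ι : Type} [Fintype ι] {τ : Rn n → ℂ}
    {q : ι → Rn n → ℂ} (h : UEP lam τ q) (hτ : IsTrigPoly τ) (hq : ∀ i, IsTrigPoly (q i))
    (ξ : Rn n) :
    ∑ μ ∈ digits lam n, ‖τ (ξ + (2 * Real.pi / lam) • intVec μ)‖ ^ 2 ≤ 1 := by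
  set M : (Fin n → ℤ) → Option ι → ℂ :=
    fun μ o => allMasks τ q o (ξ + (2 * Real.pi / lam) • intVec μ) with hM
  set S : ℝ := ∑ μ ∈ digits lam n, ‖M μ none‖ ^ 2 with hS
  have hnone : ∑ μ ∈ digits lam n, star (M μ none) * M μ none = (S : ℂ) := by
    rw [hS]
    push_cast
    refine Finset.sum_congr rfl fun μ _ => ?_
    rw [← Complex.conj_mul', Complex.star_def]
  -- the vector `∑ μ, conj (τ μ) • (row μ)` has squared norm `S`, and its component at `τ` is `S`
  have htotal : ∑ o, ‖∑ μ ∈ digits lam n, star (M μ none) * M μ o‖ ^ 2 = S := by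
    have : ((∑ o, ‖∑ μ ∈ digits lam n, star (M μ none) * M μ o‖ ^ 2 : ℝ) : ℂ) = (S : ℂ) := by
      push_cast
      calc ∑ o, ((‖∑ μ ∈ digits lam n, star (M μ none) * M μ o‖ : ℝ) : ℂ) ^ 2
          = ∑ o, ∑ μ ∈ digits lam n, ∑ μ' ∈ digits lam n,
              star (M μ none) * M μ' none * (M μ o * star (M μ' o)) := by
            refine Finset.sum_congr rfl fun o _ => ?_
            rw [← Complex.mul_conj', ← Complex.star_def, star_sum, Finset.sum_mul_sum]
            refine Finset.sum_congr rfl fun μ _ => Finset.sum_congr rfl fun μ' _ => ?_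
            rw [StarMul.star_mul, star_star]
            ring
        _ = ∑ μ ∈ digits lam n, ∑ μ' ∈ digits lam n,
              star (M μ none) * M μ' none * ∑ o, M μ o * star (M μ' o) := by
            rw [Finset.sum_comm]
            refine Finset.sum_congr rfl fun μ _ => ?_
            rw [Finset.sum_comm]
            exact Finset.sum_congr rfl fun μ' _ => (Finset.mul_sum _ _ _).symm
        _ = (S : ℂ) := by
            rw [← hnone]
            refine Finset.sum_congr rfl fun μ hμ => ?_
            rw [Finset.sum_eq_single μ]
            · rw [h.sum_mul_star hlam hτ hq, if_pos rfl, mul_one]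
            · intro μ' hμ' hne
              rw [h.sum_mul_star hlam hτ hq, if_neg, mul_zero]
              rw [rem_eq_self hμ, rem_eq_self hμ']
              exact hne.symm
            · exact fun h' => absurd hμ h'
    exact_mod_cast this
  have hle : S ^ 2 ≤ S := by
    rw [Fintype.sum_option, hnone] at htotal
    have h0 : 0 ≤ ∑ i, ‖∑ μ ∈ digits lam n, star (M μ none) * M μ (some i)‖ ^ 2 := by positivity
    rw [Complex.norm_real, Real.norm_eq_abs, sq_abs] at htotal
    linarith
  change S ≤ 1
  nlinarith

lemma UEP.norm_le_one {lam : ℕ} (hlam : 0 < lam) {ι : Type} [Fintype ι] {τ : Rn n → ℂ}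
    {q : ι → Rn n → ℂ} (h : UEP lam τ q) (hτ : IsTrigPoly τ) (hq : ∀ i, IsTrigPoly (q i))
    (ξ : Rn n) : ‖τ ξ‖ ≤ 1 := by
  have h1 := h.sum_digits_norm_sq_le hlam hτ hq ξ
  have h2 := Finset.single_le_sum
    (f := fun μ => ‖τ (ξ + (2 * Real.pi / lam) • intVec μ)‖ ^ 2)
    (fun μ _ => by positivity) (zero_mem_digits (n := n) hlam)
  simp only [intVec_zero, smul_zero, add_zero] at h2
  nlinarith [norm_nonneg (τ ξ)]

/-! ### The masks of the construction -/

section Masks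

variable {lam N : ℕ} {ν : Fin (lam ^ n) → Fin n → ℤ} {p : Fin (lam ^ n) → Rn n → ℂ}
  {r : Fin N → ℕ} {g : (l : Fin N) → Fin (r l) → Rn n → ℂ}

lemma isTrigPoly_refMask (hp : ∀ l, IsTrigPoly (p l)) : IsTrigPoly (refMask lam ν p) :=
  (IsTrigPoly.sum _ fun l _ => ((hp l).comp_smul lam).mul (isTrigPoly_cexpInt (ν l))).const_mul _

lemma isTrigPoly_waveletMask (hp : ∀ l, IsTrigPoly (p l)) (hg : ∀ l s, IsTrigPoly (g l s))
    (i : ((l : Fin N) × Fin (r l)) ⊕ Fin (lam ^ n)) : IsTrigPoly (waveletMask lam ν p g i) := by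
  rcases i with ⟨l, s⟩ | m
  · exact (isTrigPoly_refMask hp).mul ((hg l s).comp_smul lam).star
  · exact ((isTrigPoly_cexpInt (ν m)).sub
      ((isTrigPoly_refMask hp).mul ((hp m).comp_smul lam).star)).const_mul _

lemma image_eq_digits (hν : Function.Injective ν) (hν_mem : ∀ l, ν l ∈ digits lam n) :
    Finset.univ.image ν = digits lam n := by
  refine Finset.eq_of_subset_of_card_le (fun x hx => ?_) ?_
  · obtain ⟨l, _, rfl⟩ := Finset.mem_image.mp hx
    exact hν_mem l
  · rw [Finset.card_image_of_injective _ hν]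
    simp [digits]

/-- The unitary extension principle for the masks: the `q₁` contribute
`τ(ξ) conj τ(ξ+γ) (1 - lam⁻ⁿ ∑ |pₗ(lam ξ)|²)`, and the `q₂` contribute
`lam⁻ⁿ ∑ₘ e^{-i νₘ γ} + τ(ξ) conj τ(ξ+γ) (lam⁻ⁿ ∑ |pₗ(lam ξ)|² - 2)`. -/
lemma uep_waveletMask (hlam : 0 < lam) (hN : N ≤ lam ^ n)
    (hν : Function.Injective ν) (hν_mem : ∀ l, ν l ∈ digits lam n)
    (hp : ∀ l, IsTrigPoly (p l)) (hg : ∀ l s, IsTrigPoly (g l s))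
    (hpg : ∀ (l : Fin N) (ξ : Rn n),
      1 - ‖p (Fin.castLE hN l) ξ‖ ^ 2 = (lam : ℝ) ^ n * ∑ s, ‖g l s ξ‖ ^ 2)
    (hp_rest : ∀ l : Fin (lam ^ n), N ≤ (l : ℕ) → ∀ ξ, ‖p l ξ‖ ^ 2 = 1) :
    UEP lam (refMask lam ν p) (waveletMask lam ν p g) := by
  intro ξ μ hμ
  have hl : (lam : ℝ) ≠ 0 := by exact_mod_cast hlam.ne'
  have hL : (lam : ℂ) ^ n ≠ 0 := pow_ne_zero _ (by exact_mod_cast hlam.ne')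
  set γ : Rn n := (2 * Real.pi / lam) • intVec μ with hγ
  have hper : ∀ {f : Rn n → ℂ}, IsTrigPoly f →
      f ((lam : ℝ) • (ξ + γ)) = f ((lam : ℝ) • ξ) := by
    intro f hf
    rw [smul_add, hγ, smul_smul, mul_div_cancel₀ _ hl, hf.apply_add_two_pi]
  set T := refMask lam ν p ξ with hT
  set T' := refMask lam ν p (ξ + γ) with hT'
  set P : Fin (lam ^ n) → ℂ := fun l => p l ((lam : ℝ) • ξ) with hP
  set e : Fin (lam ^ n) → ℂ := fun l => cexpInt (ν l) ξ with he
  set e' : Fin (lam ^ n) → ℂ := fun l => cexpInt (ν l) (ξ + γ) with he'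
  have hTsum : ∑ l, P l * e l = (lam : ℂ) ^ n * T := by
    rw [hT, refMask, mul_inv_cancel_left₀ hL]
  have hTsum' : ∑ l, star (P l) * star (e' l) = (lam : ℂ) ^ n * star T' := by
    have : ∑ l, P l * e' l = (lam : ℂ) ^ n * T' := by
      rw [hT', refMask, mul_inv_cancel_left₀ hL]
      exact Finset.sum_congr rfl fun l _ => by rw [hper (hp l)]
    have := congrArg star this
    simpa [mul_comm] using this
  have horth : ∑ l, e l * star (e' l) = if μ = 0 then (lam : ℂ) ^ n else 0 := by
    have h1 : ∀ l, e l * star (e' l) = cexpInt (-μ) ((2 * Real.pi / lam) • intVec (ν l)) := by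
      intro l
      simp only [he, he']
      rw [cexpInt_apply_add, mul_comm (cexpInt (ν l) ξ) (cexpInt (ν l) γ), StarMul.star_mul,
        ← mul_assoc, star_cexpInt _ ξ, mul_comm (cexpInt (ν l) ξ), cexpInt_neg_mul_self, one_mul,
        hγ, cexpInt_smul_intVec_comm, star_cexpInt]
    simp_rw [h1]
    rw [← Finset.sum_image (s := Finset.univ) (g := ν)
      (f := fun k => cexpInt (-μ) ((2 * Real.pi / lam) • intVec k)) (fun a _ b _ h => hν h),
      image_eq_digits hν hν_mem, sum_digits_cexpInt hlam]
    congr 1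
    conv_rhs => rw [← rem_eq_self hμ, funext_iff]
    exact propext (forall_congr' fun i => dvd_neg.trans Int.dvd_iff_emod_eq_zero)
  have hG : ∑ l : Fin N, ∑ s, star (g l s ((lam : ℝ) • ξ)) * g l s ((lam : ℝ) • ξ)
      = ((lam : ℂ) ^ n)⁻¹ * ∑ l, (1 - star (P l) * P l) := by
    have h1 : ∀ l : Fin N, ∑ s, star (g l s ((lam : ℝ) • ξ)) * g l s ((lam : ℝ) • ξ)
        = ((lam : ℂ) ^ n)⁻¹ * (1 - star (P (Fin.castLE hN l)) * P (Fin.castLE hN l)) := by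
      intro l
      have := congrArg (fun x : ℝ => (x : ℂ)) (hpg l ((lam : ℝ) • ξ))
      push_cast at this
      rw [eq_inv_mul_iff_mul_eq₀ hL]
      simp only [hP, Complex.star_def, Complex.conj_mul']
      exact this.symm
    simp_rw [h1]
    rw [← Finset.mul_sum]
    congr 1
    rw [← Finset.sum_image (s := Finset.univ) (g := Fin.castLE hN)
      (f := fun l => 1 - star (P l) * P l) (fun a _ b _ h => Fin.castLE_injective hN h)]
    refine Finset.sum_subset (Finset.subset_univ _) fun l _ hl => ?_
    have hNl : N ≤ (l : ℕ) := by
      by_contra hlt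
      exact hl (Finset.mem_image.mpr ⟨⟨l, by omega⟩, Finset.mem_univ _, rfl⟩)
    have := congrArg (fun x : ℝ => (x : ℂ)) (hp_rest l hNl ((lam : ℝ) • ξ))
    push_cast at this
    simp only [hP, Complex.star_def, Complex.conj_mul', this, sub_self]
  set c : ℂ := (((lam : ℝ) ^ (-(n : ℝ) / 2) : ℝ) : ℂ) with hc
  have hcc : c * star c = ((lam : ℂ) ^ n)⁻¹ := by
    rw [hc, Complex.star_def, Complex.conj_ofReal, ← Complex.ofReal_mul,
      ← Real.rpow_add (by exact_mod_cast hlam)]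
    rw [show -(n : ℝ) / 2 + -(n : ℝ) / 2 = -(n : ℝ) by ring, Real.rpow_neg (by positivity),
      Real.rpow_natCast]
    push_cast
    rfl
  have hinl : ∑ x : (l : Fin N) × Fin (r l), waveletMask lam ν p g (Sum.inl x) ξ *
      star (waveletMask lam ν p g (Sum.inl x) (ξ + γ))
      = T * star T' * (((lam : ℂ) ^ n)⁻¹ * ∑ l, (1 - star (P l) * P l)) := by
    rw [← hG, Fintype.sum_sigma, Finset.mul_sum]
    refine Finset.sum_congr rfl fun l _ => ?_
    rw [Finset.mul_sum]
    refine Finset.sum_congr rfl fun s _ => ?_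
    simp only [waveletMask]
    rw [hper (hg l s), StarMul.star_mul, star_star]
    ring
  have hinr : ∑ m, waveletMask lam ν p g (Sum.inr m) ξ *
      star (waveletMask lam ν p g (Sum.inr m) (ξ + γ))
      = ((lam : ℂ) ^ n)⁻¹ * (∑ l, e l * star (e' l) - star T' * ∑ l, P l * e l
        - T * ∑ l, star (P l) * star (e' l) + T * star T' * ∑ l, star (P l) * P l) := by
    rw [Finset.mul_sum, Finset.mul_sum, Finset.mul_sum, ← Finset.sum_sub_distrib,
      ← Finset.sum_sub_distrib, ← Finset.sum_add_distrib, Finset.mul_sum]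
    refine Finset.sum_congr rfl fun m _ => ?_
    simp only [waveletMask]
    rw [hper (hp m), StarMul.star_mul, star_sub, StarMul.star_mul, star_star, ← hcc]
    simp only [hP, he, he', ← hc, ← hT, ← hT']
    ring
  rw [Fintype.sum_sum_type, hinl, hinr, hTsum, hTsum', horth, Finset.sum_sub_distrib]
  simp only [Finset.sum_const, Finset.card_univ, Fintype.card_fin, nsmul_eq_mul, Nat.cast_pow,
    mul_one]
  split_ifs <;> field_simp <;> ring

end Masks

/-! ### The unitary extension principle for coefficient sequences -/

section Coefficients

lemma sum_support_eq_sum {κ : Type*} {h : κ → (Fin n → ℤ) →₀ ℂ} {M : Finset (Fin n → ℤ)}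
    {E : Type*} [AddCommMonoid E] {o : κ} (hM : ∀ o, (h o).support ⊆ M)
    (F : (Fin n → ℤ) → ℂ → E) (hF : ∀ k, F k 0 = 0) :
    ∑ k ∈ (h o).support, F k (h o k) = ∑ k ∈ M, F k (h o k) :=
  Finset.sum_subset (hM o) fun k _ hk => by rw [Finsupp.notMem_support_iff.mp hk, hF]

variable {κ : Type*} [Fintype κ] {lam : ℕ} {h : κ → (Fin n → ℤ) →₀ ℂ} {f : κ → Rn n → ℂ}
  {M : Finset (Fin n → ℤ)}

/-- The coefficient of `e^{i d · ξ}` in the unitary extension principle condition. -/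
lemma sum_coeff_mul_cexpInt (hf : ∀ o ξ, f o ξ = ∑ k ∈ (h o).support, h o k * cexpInt (-k) ξ)
    (hM : ∀ o, (h o).support ⊆ M) {γ : Rn n} {c : ℂ}
    (huep : ∀ ξ, ∑ o, f o ξ * star (f o (ξ + γ)) = c) (d : Fin n → ℤ) :
    ∑ a ∈ M, ∑ b ∈ M, (if b - a = d then (∑ o, h o a * star (h o b)) * cexpInt b γ else 0)
      = if d = 0 then c else 0 := by
  set F : (Fin n → ℤ) →₀ ℂ := ∑ a ∈ M, ∑ b ∈ M,
    Finsupp.single (b - a) ((∑ o, h o a * star (h o b)) * cexpInt b γ) with hF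
  have hlin : Finsupp.linearCombination ℂ (cexpInt : (Fin n → ℤ) → Rn n → ℂ) F
      = Finsupp.linearCombination ℂ cexpInt (Finsupp.single 0 c) := by
    rw [hF]
    simp only [map_sum, Finsupp.linearCombination_single]
    ext ξ
    simp only [Finset.sum_apply, Pi.smul_apply, smul_eq_mul, cexpInt_zero, mul_one]
    rw [← huep ξ]
    have : ∀ o, f o ξ * star (f o (ξ + γ)) = ∑ a ∈ M, ∑ b ∈ M,
        h o a * star (h o b) * (cexpInt b γ * cexpInt (b - a) ξ) := by
      intro o
      rw [hf, hf, sum_support_eq_sum hM (fun k x => x * cexpInt (-k) ξ) (by simp),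
        sum_support_eq_sum hM (fun k x => x * cexpInt (-k) (ξ + γ)) (by simp), star_sum,
        Finset.sum_mul_sum]
      refine Finset.sum_congr rfl fun a _ => Finset.sum_congr rfl fun b _ => ?_
      rw [StarMul.star_mul, star_cexpInt, neg_neg, sub_eq_add_neg, cexpInt_add, cexpInt_apply_add]
      ring
    simp_rw [this]
    symm
    rw [Finset.sum_comm]
    refine Finset.sum_congr rfl fun a _ => ?_
    rw [Finset.sum_comm]
    refine Finset.sum_congr rfl fun b _ => ?_
    simp_rw [Finset.sum_mul]
    exact Finset.sum_congr rfl fun o _ => by ring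
  have hFd := DFunLike.congr_fun (linearIndependent_cexpInt hlin) d
  rw [hF] at hFd
  simp only [Finsupp.finsetSum_apply, Finsupp.single_apply] at hFd
  rw [hFd]
  simp only [eq_comm]

/-- The unitary extension principle in terms of the coefficients of the masks. -/
lemma sum_coeff_mul_star (hlam : 0 < lam)
    (hf : ∀ o ξ, f o ξ = ∑ k ∈ (h o).support, h o k * cexpInt (-k) ξ)
    (hM : ∀ o, (h o).support ⊆ M)
    (huep : ∀ ξ, ∀ μ ∈ digits lam n,
      ∑ o, f o ξ * star (f o (ξ + (2 * Real.pi / lam) • intVec μ)) = if μ = 0 then 1 else 0)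
    (ρ d : Fin n → ℤ) :
    ∑ a ∈ M, ∑ b ∈ M, (if b - a = d ∧ rem lam a = rem lam ρ then
      ∑ o, h o a * star (h o b) else 0) = if d = 0 then ((lam : ℂ) ^ n)⁻¹ else 0 := by
  have hL : (lam : ℂ) ^ n ≠ 0 := pow_ne_zero _ (by exact_mod_cast hlam.ne')
  have h1 : ∀ μ ∈ digits lam n, ∑ a ∈ M, ∑ b ∈ M,
      (if b - a = d then (∑ o, h o a * star (h o b)) *
        cexpInt (a - ρ) ((2 * Real.pi / lam) • intVec μ) else 0)
      = (if d = 0 then (if μ = 0 then 1 else 0) else 0) *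
        cexpInt (-(ρ + d)) ((2 * Real.pi / lam) • intVec μ) := by
    intro μ hμ
    rw [← sum_coeff_mul_cexpInt hf hM (fun ξ => huep ξ μ hμ) d, Finset.sum_mul]
    refine Finset.sum_congr rfl fun a _ => ?_
    rw [Finset.sum_mul]
    refine Finset.sum_congr rfl fun b _ => ?_
    split_ifs with hd
    · rw [mul_assoc, ← cexpInt_add, ← hd]
      congr 2
      abel
    · rw [zero_mul]
  have h2 := Finset.sum_congr (s₁ := digits lam n) rfl h1
  have h3 : ∑ μ ∈ digits lam n, (if d = 0 then (if μ = 0 then (1 : ℂ) else 0) else 0) *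
        cexpInt (-(ρ + d)) ((2 * Real.pi / lam) • intVec μ) = if d = 0 then 1 else 0 := by
    rw [Finset.sum_eq_single 0]
    · rw [intVec_zero, smul_zero, cexpInt_apply_zero, mul_one, if_pos rfl]
    · intro μ _ hμ
      simp [hμ]
    · exact fun h' => absurd (zero_mem_digits hlam) h'
  rw [h3, Finset.sum_comm] at h2
  have h4 : ∑ a ∈ M, ∑ b ∈ M, (if b - a = d ∧ rem lam a = rem lam ρ then
      ∑ o, h o a * star (h o b) else 0) * (lam : ℂ) ^ n = if d = 0 then 1 else 0 := by
    rw [← h2]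
    refine Finset.sum_congr rfl fun a _ => ?_
    rw [Finset.sum_comm]
    refine Finset.sum_congr rfl fun b _ => ?_
    by_cases hd : b - a = d
    · simp only [hd, true_and, if_true]
      rw [← Finset.mul_sum, sum_digits_cexpInt hlam]
      simp only [rem_eq_rem_iff, mul_ite, ite_mul, zero_mul, mul_zero]
    · simp [hd]
  simp_rw [← Finset.sum_mul] at h4
  rw [(eq_mul_inv_iff_mul_eq₀ hL).mpr h4, ite_mul, one_mul, zero_mul]

end Coefficients

/-- Division with remainder identifies `ℤⁿ` with `digits lam n × ℤⁿ`. -/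
def divEquiv {lam : ℕ} (hlam : 0 < lam) :
    (digits lam n) × (Fin n → ℤ) ≃ (Fin n → ℤ) where
  toFun x := (lam : ℤ) • x.2 + (x.1 : Fin n → ℤ)
  invFun m := (⟨rem lam m, rem_mem_digits hlam m⟩, quo lam m)
  left_inv x := by
    have h1 : rem lam ((lam : ℤ) • x.2 + (x.1 : Fin n → ℤ)) = x.1 := by
      rw [rem_smul_add, rem_eq_self x.1.2]
    have hl : (lam : ℤ) ≠ 0 := by exact_mod_cast hlam.ne'
    refine Prod.ext (Subtype.ext h1) ?_
    have h2 := quo_add_rem lam ((lam : ℤ) • x.2 + (x.1 : Fin n → ℤ))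
    rw [h1, add_left_inj] at h2
    exact smul_right_injective _ hl h2
  right_inv m := quo_add_rem lam m

lemma divEquiv_apply {lam : ℕ} (hlam : 0 < lam) (x : (digits lam n) × (Fin n → ℤ)) :
    divEquiv hlam x = (lam : ℤ) • x.2 + (x.1 : Fin n → ℤ) := rfl

lemma injective_smul_add {lam : ℕ} (hlam : 0 < lam) (m : Fin n → ℤ) :
    Function.Injective fun k : Fin n → ℤ => (lam : ℤ) • k + m := by
  have hl : (lam : ℤ) ≠ 0 := by exact_mod_cast hlam.ne'
  exact (add_left_injective m).comp (smul_right_injective _ hl)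

/-- The perfect reconstruction identity: the decomposition of a square summable sequence by filters
satisfying the unitary extension principle preserves the norm, up to the factor `lam⁻ⁿ`. -/
lemma hasSum_norm_sq_filter {κ : Type*} [Fintype κ] {lam : ℕ} (hlam : 0 < lam)
    {h : κ → (Fin n → ℤ) →₀ ℂ} {f : κ → Rn n → ℂ}
    (hf : ∀ o ξ, f o ξ = ∑ k ∈ (h o).support, h o k * cexpInt (-k) ξ)
    (huep : ∀ ξ, ∀ μ ∈ digits lam n,
      ∑ o, f o ξ * star (f o (ξ + (2 * Real.pi / lam) • intVec μ)) = if μ = 0 then 1 else 0)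
    {x : (Fin n → ℤ) → ℂ} {S : ℝ} (hx : HasSum (fun k => ‖x k‖ ^ 2) S) :
    HasSum (fun k : Fin n → ℤ =>
      ∑ o, ‖∑ m ∈ (h o).support, star (h o m) * x ((lam : ℤ) • k + m)‖ ^ 2)
      (((lam : ℝ) ^ n)⁻¹ * S) := by
  classical
  set M : Finset (Fin n → ℤ) := Finset.univ.biUnion fun o => (h o).support with hMdef
  have hM : ∀ o, (h o).support ⊆ M := fun o =>
    Finset.subset_biUnion_of_mem (fun o => (h o).support) (Finset.mem_univ o)
  set C : (Fin n → ℤ) → (Fin n → ℤ) → ℂ := fun a b => ∑ o, h o a * star (h o b) with hC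
  -- the correlations `∑ₖ x(lam k + b) conj x(lam k + a)`
  have hsq : ∀ a, Summable fun k : Fin n → ℤ => ‖x ((lam : ℤ) • k + a)‖ ^ 2 := fun a =>
    hx.summable.comp_injective (injective_smul_add hlam a)
  have hX : ∀ a b, Summable fun k : Fin n → ℤ =>
      x ((lam : ℤ) • k + b) * star (x ((lam : ℤ) • k + a)) := by
    intro a b
    have hadd := (hsq a).add (hsq b)
    refine Summable.of_norm_bounded hadd fun k => ?_
    rw [norm_mul, norm_star]
    nlinarith [sq_nonneg (‖x ((lam : ℤ) • k + a)‖ - ‖x ((lam : ℤ) • k + b)‖),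
      sq_nonneg (‖x ((lam : ℤ) • k + a)‖), sq_nonneg (‖x ((lam : ℤ) • k + b)‖)]
  set B : (Fin n → ℤ) → (Fin n → ℤ) → ℂ := fun ρ d =>
    ∑' k : Fin n → ℤ, x ((lam : ℤ) • k + (ρ + d)) * star (x ((lam : ℤ) • k + ρ)) with hB
  have hBX : ∀ a b, HasSum (fun k : Fin n → ℤ =>
      x ((lam : ℤ) • k + b) * star (x ((lam : ℤ) • k + a))) (B (rem lam a) (b - a)) := by
    intro a b
    have := (hX (rem lam a) (rem lam a + (b - a))).hasSum
    rw [← (Equiv.addRight (quo lam a)).hasSum_iff] at this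
    convert this using 2 with k
    simp only [Function.comp, Equiv.coe_addRight, smul_add, add_assoc]
    rw [← add_assoc ((lam : ℤ) • quo lam a), quo_add_rem, add_sub_cancel]
  -- the diagonal correlations add up to the norm of `x`
  have hdiag : ∑ ρ ∈ digits lam n, B ρ 0 = (S : ℂ) := by
    have h0 : HasSum (fun y => ‖x (divEquiv hlam y)‖ ^ 2) S :=
      ((divEquiv hlam).hasSum_iff (f := fun k => ‖x k‖ ^ 2)).mpr hx
    have h1 : HasSum (fun y => ((‖x (divEquiv hlam y)‖ ^ 2 : ℝ) : ℂ)) (S : ℂ) :=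
      Complex.hasSum_ofReal.mpr h0
    have h2 : ∀ ρ : digits lam n, HasSum (fun k : Fin n → ℤ =>
        ((‖x (divEquiv hlam (ρ, k))‖ ^ 2 : ℝ) : ℂ)) (B ρ 0) := by
      intro ρ
      have := (hX (ρ : Fin n → ℤ) (ρ + 0)).hasSum
      convert this using 2 with k
      rw [divEquiv_apply, add_zero, Complex.star_def, Complex.mul_conj', Complex.ofReal_pow]
    rw [← Finset.sum_coe_sort]
    exact (hasSum_fintype _).unique (h1.prod_fiberwise h2)
  -- expand the squares, sum over `k`, and group the pairs `(a, b)` by `a mod lam` and `b - a`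
  have hexp : ∀ k : Fin n → ℤ,
      ((∑ o, ‖∑ m ∈ (h o).support, star (h o m) * x ((lam : ℤ) • k + m)‖ ^ 2 : ℝ) : ℂ)
      = ∑ a ∈ M, ∑ b ∈ M, C a b * (x ((lam : ℤ) • k + b) * star (x ((lam : ℤ) • k + a))) := by
    intro k
    push_cast
    have : ∀ o, ((‖∑ m ∈ (h o).support, star (h o m) * x ((lam : ℤ) • k + m)‖ : ℝ) : ℂ) ^ 2
        = ∑ a ∈ M, ∑ b ∈ M, h o a * star (h o b) *
          (x ((lam : ℤ) • k + b) * star (x ((lam : ℤ) • k + a))) := by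
      intro o
      rw [sum_support_eq_sum hM (fun m y => star y * x ((lam : ℤ) • k + m)) (by simp),
        ← Complex.conj_mul', ← Complex.star_def, star_sum, Finset.sum_mul_sum]
      refine Finset.sum_congr rfl fun a _ => Finset.sum_congr rfl fun b _ => ?_
      rw [StarMul.star_mul, star_star]
      ring
    simp_rw [this, hC, Finset.sum_mul]
    rw [Finset.sum_comm]
    exact Finset.sum_congr rfl fun a _ => Finset.sum_comm
  have hsum := hasSum_sum (s := M) fun a _ => hasSum_sum (s := M) fun b _ =>
    (hBX a b).mul_left (C a b)
  set D : Finset (Fin n → ℤ) := insert 0 ((M ×ˢ M).image fun y => y.2 - y.1) with hD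
  have hins : ∀ a ∈ M, ∀ b ∈ M, C a b * B (rem lam a) (b - a)
      = ∑ ρ ∈ digits lam n, ∑ d ∈ D,
        B ρ d * if b - a = d ∧ rem lam a = rem lam ρ then C a b else 0 := by
    intro a ha b hb
    rw [Finset.sum_eq_single (rem lam a), Finset.sum_eq_single (b - a)]
    · rw [if_pos ⟨rfl, (rem_eq_self (rem_mem_digits hlam a)).symm⟩, mul_comm]
    · intro d _ hd
      rw [if_neg fun h' => hd h'.1.symm, mul_zero]
    · intro h'
      exact absurd (Finset.mem_insert_of_mem (Finset.mem_image.mpr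
        ⟨(a, b), Finset.mk_mem_product ha hb, rfl⟩)) h'
    · intro ρ hρ hne
      refine Finset.sum_eq_zero fun d _ => ?_
      rw [if_neg, mul_zero]
      rw [rem_eq_self hρ]
      exact fun h' => hne h'.2.symm
    · exact fun h' => absurd (rem_mem_digits hlam a) h'
  have hval : (((((lam : ℝ) ^ n)⁻¹ * S : ℝ)) : ℂ)
      = ∑ a ∈ M, ∑ b ∈ M, C a b * B (rem lam a) (b - a) := by
    rw [Finset.sum_congr rfl fun a ha => Finset.sum_congr rfl fun b hb => hins a ha b hb]
    calc (((((lam : ℝ) ^ n)⁻¹ * S : ℝ)) : ℂ)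
      _ = ∑ ρ ∈ digits lam n, ∑ d ∈ D, B ρ d * (if d = 0 then ((lam : ℂ) ^ n)⁻¹ else 0) := by
          push_cast
          rw [← hdiag, Finset.mul_sum]
          refine Finset.sum_congr rfl fun ρ _ => ?_
          simp only [mul_ite, mul_zero]
          rw [Finset.sum_ite_eq' D 0, if_pos (Finset.mem_insert_self _ _), mul_comm]
      _ = ∑ ρ ∈ digits lam n, ∑ d ∈ D, ∑ a ∈ M, ∑ b ∈ M,
          B ρ d * (if b - a = d ∧ rem lam a = rem lam ρ then C a b else 0) := by
          refine Finset.sum_congr rfl fun ρ _ => Finset.sum_congr rfl fun d _ => ?_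
          rw [← sum_coeff_mul_star hlam hf hM huep ρ d]
          simp_rw [Finset.mul_sum]
          rfl
      _ = _ := by
          rw [Finset.sum_congr rfl fun ρ _ => Finset.sum_comm, Finset.sum_comm]
          refine Finset.sum_congr rfl fun a _ => ?_
          rw [Finset.sum_congr rfl fun ρ _ => Finset.sum_comm, Finset.sum_comm]
  rw [← Complex.hasSum_ofReal, hval]
  simp_rw [hexp]
  exact hsum

/-! ### The infinite product -/

/-- The partial product `∏_{j=1}^J τ(lam^{-j} ξ)`. -/
noncomputable def partialProd (lam : ℕ) (τ : Rn n → ℂ) (J : ℕ) (ξ : Rn n) : ℂ :=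
  ∏ j ∈ Finset.range J, τ (((lam : ℝ) ^ (j + 1))⁻¹ • ξ)

/-- The infinite product `∏_{j≥1} τ(lam^{-j} ξ)`, the Fourier transform of the refinable function
with mask `τ`. -/
noncomputable def phiHat (lam : ℕ) (τ : Rn n → ℂ) (ξ : Rn n) : ℂ :=
  ∏' j : ℕ, τ (((lam : ℝ) ^ (j + 1))⁻¹ • ξ)

lemma partialProd_succ {lam : ℕ} (τ : Rn n → ℂ) (J : ℕ) (ξ : Rn n) :
    partialProd lam τ (J + 1) ξ
      = τ ((lam : ℝ)⁻¹ • ξ) * partialProd lam τ J ((lam : ℝ)⁻¹ • ξ) := by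
  rw [partialProd, Finset.prod_range_succ', mul_comm]
  simp only [zero_add, pow_one, partialProd, smul_smul]
  congr 1
  refine Finset.prod_congr rfl fun j _ => ?_
  rw [pow_succ ((lam : ℝ)) (j + 1), mul_inv]

lemma partialProd_apply_zero {lam : ℕ} {τ : Rn n → ℂ} (h0 : τ 0 = 1) (J : ℕ) :
    partialProd lam τ J 0 = 1 := by
  simp [partialProd, h0]

lemma continuous_partialProd {lam : ℕ} {τ : Rn n → ℂ} (hτ : IsTrigPoly τ) (J : ℕ) :
    Continuous (partialProd lam τ J) :=
  continuous_finsetProd _ fun _ _ => hτ.continuous.comp (continuous_const_smul _)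

lemma norm_partialProd_le {lam : ℕ} {τ : Rn n → ℂ} (h1 : ∀ ξ, ‖τ ξ‖ ≤ 1) (J : ℕ) (ξ : Rn n) :
    ‖partialProd lam τ J ξ‖ ≤ 1 := by
  rw [partialProd, norm_prod]
  exact Finset.prod_le_one (fun _ _ => norm_nonneg _) fun _ _ => h1 _

lemma hasProd_phiHat {lam : ℕ} (hlam : 2 ≤ lam) {τ : Rn n → ℂ} (hτ : IsTrigPoly τ)
    (h0 : τ 0 = 1) (ξ : Rn n) :
    HasProd (fun j : ℕ => τ (((lam : ℝ) ^ (j + 1))⁻¹ • ξ)) (phiHat lam τ ξ) := by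
  have h2 : (2 : ℝ) ≤ lam := by exact_mod_cast hlam
  obtain ⟨C, hC, hb⟩ := hτ.exists_norm_sub_le
  have hgeo : Summable fun j : ℕ => C * ‖ξ‖ * (lam : ℝ)⁻¹ * ((lam : ℝ)⁻¹) ^ j :=
    (summable_geometric_of_lt_one (by positivity)
      (inv_lt_one_of_one_lt₀ (by linarith))).mul_left _
  have hs : Summable fun j : ℕ => ‖τ (((lam : ℝ) ^ (j + 1))⁻¹ • ξ) - 1‖ := by
    refine Summable.of_nonneg_of_le (fun _ => norm_nonneg _) (fun j => ?_) hgeo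
    have := hb (((lam : ℝ) ^ (j + 1))⁻¹ • ξ)
    rw [h0, norm_smul, Real.norm_of_nonneg (by positivity)] at this
    refine this.trans (le_of_eq ?_)
    rw [pow_succ, mul_inv, inv_pow]
    ring
  have := (multipliable_one_add_of_summable hs).hasProd
  simpa [phiHat] using this

lemma tendsto_partialProd {lam : ℕ} (hlam : 2 ≤ lam) {τ : Rn n → ℂ} (hτ : IsTrigPoly τ)
    (h0 : τ 0 = 1) (ξ : Rn n) :
    Filter.Tendsto (fun J => partialProd lam τ J ξ) Filter.atTop (nhds (phiHat lam τ ξ)) :=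
  (hasProd_phiHat hlam hτ h0 ξ).tendsto_prod_nat

lemma phiHat_smul {lam : ℕ} (hlam : 2 ≤ lam) {τ : Rn n → ℂ} (hτ : IsTrigPoly τ)
    (h0 : τ 0 = 1) (ξ : Rn n) :
    phiHat lam τ ((lam : ℝ) • ξ) = τ ξ * phiHat lam τ ξ := by
  have hl : (lam : ℝ) ≠ 0 := by exact_mod_cast (by omega : lam ≠ 0)
  have h1 := (tendsto_partialProd hlam hτ h0 ((lam : ℝ) • ξ)).comp (Filter.tendsto_add_atTop_nat 1)
  have h2 := (tendsto_partialProd hlam hτ h0 ξ).const_mul (τ ξ)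
  refine tendsto_nhds_unique h1 (h2.congr fun J => ?_)
  simp only [Function.comp, partialProd_succ, inv_smul_smul₀ hl]

lemma measurable_phiHat {lam : ℕ} (hlam : 2 ≤ lam) {τ : Rn n → ℂ} (hτ : IsTrigPoly τ)
    (h0 : τ 0 = 1) : Measurable (phiHat lam τ) :=
  measurable_of_tendsto_metrizable (fun J => (continuous_partialProd (lam := lam) hτ J).measurable)
    (tendsto_pi_nhds.mpr fun ξ => tendsto_partialProd hlam hτ h0 ξ)

/-- Translates by integer vectors which are distinct modulo `lam ^ J` have partial products of
total square sum at most `1`; this follows by iterating the sub-QMF condition. -/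
lemma sum_norm_sq_partialProd_le {lam : ℕ} (hlam : 0 < lam) {τ : Rn n → ℂ} (hτ : IsTrigPoly τ)
    (hsub : ∀ ξ, ∑ μ ∈ digits lam n, ‖τ (ξ + (2 * Real.pi / lam) • intVec μ)‖ ^ 2 ≤ 1)
    (J : ℕ) (ξ : Rn n) (F : Finset (Fin n → ℤ))
    (hF : Set.InjOn (rem (lam ^ J)) (F : Set (Fin n → ℤ))) :
    ∑ k ∈ F, ‖partialProd lam τ J (ξ + (2 * Real.pi) • intVec k)‖ ^ 2 ≤ 1 := by
  have hl : (lam : ℝ) ≠ 0 := by exact_mod_cast hlam.ne'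
  have hlz : (lam : ℤ) ≠ 0 := by exact_mod_cast hlam.ne'
  induction J generalizing ξ F with
  | zero =>
    have hcard : F.card ≤ 1 := Finset.card_le_one.mpr fun a ha b hb =>
      hF ha hb (funext fun i => by simp [rem])
    simp only [partialProd, Finset.range_zero, Finset.prod_empty, norm_one, one_pow,
      Finset.sum_const, nsmul_eq_mul, mul_one]
    exact_mod_cast hcard
  | succ J ih =>
    set η : (Fin n → ℤ) → Rn n := fun μ => (lam : ℝ)⁻¹ • ξ + (2 * Real.pi / lam) • intVec μ with hη
    have hpt : ∀ k : Fin n → ℤ, partialProd lam τ (J + 1) (ξ + (2 * Real.pi) • intVec k)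
        = τ (η (rem lam k)) *
          partialProd lam τ J (η (rem lam k) + (2 * Real.pi) • intVec (quo lam k)) := by
      intro k
      have : (lam : ℝ)⁻¹ • (ξ + (2 * Real.pi) • intVec k)
          = η (rem lam k) + (2 * Real.pi) • intVec (quo lam k) := by
        conv_lhs => rw [← rem_add_quo lam k, intVec_add, intVec_natCast_smul]
        simp only [hη, smul_add, smul_smul, add_assoc]
        congr 3
        · ring
        · field_simp
      rw [partialProd_succ, this, hτ.apply_add_two_pi]
    rw [← Finset.sum_fiberwise_of_maps_to (g := rem lam) (t := digits lam n)
      fun k _ => rem_mem_digits hlam k]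
    refine (Finset.sum_le_sum fun μ hμ => ?_).trans (hsub ((lam : ℝ)⁻¹ • ξ))
    have hquo : Set.InjOn (quo lam)
        ((F.filter fun k => rem lam k = μ : Finset _) : Set (Fin n → ℤ)) := by
      intro a ha b hb hab
      simp only [Finset.coe_filter, Set.mem_ofPred_eq] at ha hb
      rw [← rem_add_quo lam a, ← rem_add_quo lam b, ha.2, hb.2, hab]
    have hinj : Set.InjOn (rem (lam ^ J))
        (((F.filter fun k => rem lam k = μ).image (quo lam) : Finset _) : Set (Fin n → ℤ)) := by
      intro a ha b hb hab
      simp only [Finset.coe_image, Finset.coe_filter, Set.mem_image, Set.mem_ofPred_eq] at ha hb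
      obtain ⟨a', ⟨ha', hra⟩, rfl⟩ := ha
      obtain ⟨b', ⟨hb', hrb⟩, rfl⟩ := hb
      rw [rem_eq_rem_iff] at hab
      have : a' = b' := by
        refine hF ha' hb' (rem_eq_rem_iff.mpr fun i => ?_)
        rw [← rem_add_quo lam a', ← rem_add_quo lam b', hra, hrb, add_sub_add_left_eq_sub,
          ← smul_sub]
        have := mul_dvd_mul_left (lam : ℤ) (hab i)
        rw [Pi.smul_apply, smul_eq_mul]
        refine dvd_trans (dvd_of_eq ?_) this
        push_cast
        ring
      rw [this]
    calc ∑ k ∈ F.filter (fun k => rem lam k = μ),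
          ‖partialProd lam τ (J + 1) (ξ + (2 * Real.pi) • intVec k)‖ ^ 2
        = ∑ k ∈ F.filter (fun k => rem lam k = μ), ‖τ (η μ)‖ ^ 2 *
          ‖partialProd lam τ J (η μ + (2 * Real.pi) • intVec (quo lam k))‖ ^ 2 := by
          refine Finset.sum_congr rfl fun k hk => ?_
          rw [hpt, (Finset.mem_filter.mp hk).2, norm_mul, mul_pow]
      _ = ‖τ (η μ)‖ ^ 2 * ∑ m ∈ (F.filter fun k => rem lam k = μ).image (quo lam),
          ‖partialProd lam τ J (η μ + (2 * Real.pi) • intVec m)‖ ^ 2 := by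
          rw [Finset.sum_image hquo, Finset.mul_sum]
      _ ≤ ‖τ (η μ)‖ ^ 2 * 1 := by
          gcongr
          exact ih _ _ hinj
      _ = _ := mul_one _

lemma sum_norm_sq_phiHat_le {lam : ℕ} (hlam : 2 ≤ lam) {τ : Rn n → ℂ} (hτ : IsTrigPoly τ)
    (h0 : τ 0 = 1)
    (hsub : ∀ ξ, ∑ μ ∈ digits lam n, ‖τ (ξ + (2 * Real.pi / lam) • intVec μ)‖ ^ 2 ≤ 1)
    (ξ : Rn n) (F : Finset (Fin n → ℤ)) :
    ∑ k ∈ F, ‖phiHat lam τ (ξ + (2 * Real.pi) • intVec k)‖ ^ 2 ≤ 1 := by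
  have hlim := tendsto_finsetSum F fun k _ =>
    ((tendsto_partialProd hlam hτ h0 (ξ + (2 * Real.pi) • intVec k)).norm.pow 2)
  refine le_of_tendsto hlim ?_
  -- for large `J` the elements of `F` are distinct modulo `lam ^ J`
  obtain ⟨R, hR⟩ : ∃ R : ℕ, ∀ a ∈ F, ∀ b ∈ F, ∀ i, |(a - b) i| < R := by
    refine ⟨∑ a ∈ F, ∑ b ∈ F, ∑ i, ((a - b) i).natAbs + 1, fun a ha b hb i => ?_⟩
    have h1 := Finset.single_le_sum (f := fun i => ((a - b) i).natAbs) (fun _ _ => Nat.zero_le _)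
      (Finset.mem_univ i)
    have h2 := Finset.single_le_sum (f := fun b => ∑ i, ((a - b) i).natAbs)
      (fun _ _ => Nat.zero_le _) hb
    have h3 := Finset.single_le_sum (f := fun a => ∑ b ∈ F, ∑ i, ((a - b) i).natAbs)
      (fun _ _ => Nat.zero_le _) ha
    rw [Int.abs_eq_natAbs]
    have := (h1.trans h2).trans h3
    exact_mod_cast Nat.lt_succ_of_le this
  filter_upwards [Filter.eventually_ge_atTop R] with J hJ
  refine sum_norm_sq_partialProd_le (by omega) hτ hsub J ξ F fun a ha b hb hab => ?_
  rw [rem_eq_rem_iff] at hab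
  ext i
  have h1 := Int.eq_zero_of_abs_lt_dvd (hab i) <| (hR a ha b hb i).trans_le (by
    have : R ≤ lam ^ J := hJ.trans (Nat.lt_pow_self (by omega)).le
    exact_mod_cast this)
  exact sub_eq_zero.mp h1

/-! ### Integration over the tiling of `ℝⁿ` by unit cubes -/

/-- The lower corner of the unit cube with integer vertices which contains `x`. -/
noncomputable def floorVec (x : Rn n) : Fin n → ℤ := fun i => ⌊x i⌋

lemma measurable_floorVec : Measurable (floorVec : Rn n → Fin n → ℤ) :=
  measurable_pi_lambda _ fun i => Int.measurable_floor.comp (by fun_prop)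

lemma floorVec_add_intVec (x : Rn n) (k : Fin n → ℤ) :
    floorVec (x + intVec k) = floorVec x + k := by
  ext i
  simp [floorVec, intVec]

lemma volume_floorVec_zero : volume (floorVec ⁻¹' {(0 : Fin n → ℤ)} : Set (Rn n)) = 1 := by
  have : (floorVec ⁻¹' {(0 : Fin n → ℤ)} : Set (Rn n))
      = WithLp.ofLp ⁻¹' (Set.univ.pi fun _ => Set.Ico (0 : ℝ) 1) := by
    ext x
    simp [floorVec, funext_iff, Int.floor_eq_zero_iff]
  rw [this, (PiLp.volume_preserving_ofLp (Fin n)).measure_preimage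
    (MeasurableSet.univ_pi fun _ => measurableSet_Ico).nullMeasurableSet]
  simp [Real.volume_Ico, volume_pi, Measure.pi_pi]

lemma lintegral_eq_tsum_cube (G : Rn n → ENNReal) :
    ∫⁻ x, G x = ∑' k : Fin n → ℤ, ∫⁻ x in floorVec ⁻¹' {0}, G (x + intVec k) := by
  have hU : (⋃ k : Fin n → ℤ, (floorVec ⁻¹' {k} : Set (Rn n))) = Set.univ := by
    ext x; simp
  have hdisj : Pairwise (Function.onFun Disjoint
      fun k : Fin n → ℤ => (floorVec ⁻¹' {k} : Set (Rn n))) :=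
    fun k l hkl => (Set.disjoint_singleton.mpr hkl).preimage _
  rw [← setLIntegral_univ G, ← hU,
    lintegral_iUnion (fun k => measurable_floorVec (measurableSet_singleton k)) hdisj]
  refine tsum_congr fun k => ?_
  have hmp := measurePreserving_add_right (volume : Measure (Rn n)) (intVec k)
  have h1 := hmp.setLIntegral_comp_preimage_emb
    (MeasurableEquiv.addRight (intVec k)).measurableEmbedding G (floorVec ⁻¹' {k})
  rw [← h1]
  congr 2
  ext x
  simp [floorVec_add_intVec]

/-- The sum of `H` over `ℤⁿ` is the integral of the step function `H ∘ floorVec`. -/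
lemma lintegral_comp_floorVec (H : (Fin n → ℤ) → ENNReal) :
    ∫⁻ x : Rn n, H (floorVec x) = ∑' k, H k := by
  rw [lintegral_eq_tsum_cube]
  refine tsum_congr fun k => ?_
  rw [setLIntegral_congr_fun (g := fun _ => H k)
    (measurable_floorVec (measurableSet_singleton 0)) fun x hx => ?_]
  · rw [setLIntegral_const, volume_floorVec_zero, mul_one]
  · have : floorVec x = 0 := hx
    simp only [floorVec_add_intVec, this, zero_add]

/-- The infinite product is square integrable. The argument is scaled by `2π` to fit the
normalization of the Fourier transform in Mathlib. -/
lemma memLp_phiHat {lam : ℕ} (hlam : 2 ≤ lam) {τ : Rn n → ℂ} (hτ : IsTrigPoly τ)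
    (h0 : τ 0 = 1)
    (hsub : ∀ ξ, ∑ μ ∈ digits lam n, ‖τ (ξ + (2 * Real.pi / lam) • intVec μ)‖ ^ 2 ≤ 1) :
    MemLp (fun ξ : Rn n => phiHat lam τ ((2 * Real.pi) • ξ)) 2 := by
  have hmeas : Measurable fun ξ : Rn n => phiHat lam τ ((2 * Real.pi) • ξ) :=
    (measurable_phiHat hlam hτ h0).comp (measurable_const_smul _)
  refine ⟨hmeas.aestronglyMeasurable, ?_⟩
  rw [eLpNorm_lt_top_iff_lintegral_rpow_enorm_lt_top (by norm_num) (by norm_num)]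
  refine lt_of_le_of_lt ?_ ENNReal.one_lt_top
  have hmeas' : ∀ k : Fin n → ℤ, AEMeasurable
      (fun x : Rn n => ‖phiHat lam τ ((2 * Real.pi) • (x + intVec k))‖ₑ ^ (2 : ENNReal).toReal)
      (volume.restrict (floorVec ⁻¹' {0})) := fun k =>
    ((hmeas.comp (measurable_add_const (intVec k))).enorm.pow_const _).aemeasurable
  rw [lintegral_eq_tsum_cube, ← lintegral_tsum hmeas']
  refine (lintegral_mono (g := fun _ => 1) fun x => ?_).trans ?_
  · rw [ENNReal.tsum_eq_iSup_sum]
    refine iSup_le fun F => ?_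
    have := sum_norm_sq_phiHat_le hlam hτ h0 hsub ((2 * Real.pi) • x) F
    rw [← ENNReal.ofReal_le_one, ENNReal.ofReal_sum_of_nonneg fun _ _ => by positivity] at this
    refine le_trans (le_of_eq (Finset.sum_congr rfl fun k _ => ?_)) this
    rw [smul_add, ENNReal.ofReal_pow (norm_nonneg _), ofReal_norm]
    norm_num
  · rw [setLIntegral_one, volume_floorVec_zero]

section FourierSide

open scoped SchwartzMap ContDiff

/-! ### The Fourier transform on `L²` by duality -/

lemma integral_fourier_mul_schwartz (u : L2 n) (s : 𝓢(Rn n, ℂ)) :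
    ∫ x, ((𝓕 u : L2 n) : Rn n → ℂ) x * s x = ∫ x, u x * (𝓕 s) x := by
  have h := DFunLike.congr_fun (Lp.fourier_toTemperedDistribution_eq u) s
  rw [TemperedDistribution.fourier_apply, Lp.toTemperedDistribution_apply,
    Lp.toTemperedDistribution_apply] at h
  simp only [smul_eq_mul, mul_comm (s _)] at h
  simp only [← h, mul_comm]

/-- A function whose integrals against test functions are those of `𝓕 u` is `𝓕 u`. -/
lemma fourier_ae_eq_of_forall_integral {u : L2 n} {v : Rn n → ℂ} (hv : MemLp v 2)
    (h : ∀ s : 𝓢(Rn n, ℂ), HasCompactSupport s → ∫ x, v x * s x = ∫ x, u x * (𝓕 s) x) :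
    ((𝓕 u : L2 n) : Rn n → ℂ) =ᵐ[volume] v := by
  refine ae_eq_of_integral_contDiff_smul_eq
    ((Lp.memLp (𝓕 u : L2 n)).locallyIntegrable (by norm_num))
    (hv.locallyIntegrable (by norm_num)) fun g hg hgc => ?_
  have hg₁ : HasCompactSupport (Complex.ofRealCLM ∘ g) := hgc.comp_left rfl
  have hg₂ : ContDiff ℝ ∞ (Complex.ofRealCLM ∘ g) := by fun_prop
  have hS : HasCompactSupport (hg₁.toSchwartzMap hg₂) := by
    rwa [show ⇑(hg₁.toSchwartzMap hg₂) = Complex.ofRealCLM ∘ g from rfl]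
  have h1 := integral_fourier_mul_schwartz u (hg₁.toSchwartzMap hg₂)
  rw [← h (hg₁.toSchwartzMap hg₂) hS] at h1
  simpa [mul_comm] using h1

/-! ### Exponential sums with frequencies in a ball -/

/-- The functions `ξ ↦ ∑ c_a e^{-i a · ξ}`, the sum being finite, with frequencies `‖a‖ ≤ R`. -/
noncomputable def expSpan (n : ℕ) (R : ℝ) : Submodule ℂ (Rn n → ℂ) :=
  Submodule.span ℂ {F | ∃ a : Rn n, ‖a‖ ≤ R ∧
    F = fun ξ => Complex.exp (-(Complex.I * ((inner ℝ a ξ : ℝ) : ℂ)))}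

lemma expSpan_mono {R S : ℝ} (h : R ≤ S) : expSpan n R ≤ expSpan n S :=
  Submodule.span_mono fun _ ⟨a, ha, hF⟩ => ⟨a, ha.trans h, hF⟩

lemma mul_mem_expSpan {R S : ℝ} {F G : Rn n → ℂ} (hF : F ∈ expSpan n R) (hG : G ∈ expSpan n S) :
    F * G ∈ expSpan n (R + S) := by
  have := Submodule.mul_mem_mul hF hG
  rw [expSpan, expSpan, Submodule.span_mul_span] at this
  refine Submodule.span_mono ?_ this
  rintro _ ⟨_, ⟨a, ha, rfl⟩, _, ⟨b, hb, rfl⟩, rfl⟩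
  refine ⟨a + b, (norm_add_le _ _).trans (add_le_add ha hb), ?_⟩
  ext ξ
  simp only [Pi.mul_apply, ← Complex.exp_add, inner_add_left]
  congr 1
  push_cast
  ring

lemma comp_smul_mem_expSpan {R c : ℝ} (hc : 0 ≤ c) {F : Rn n → ℂ} (hF : F ∈ expSpan n R) :
    (fun ξ => F (c • ξ)) ∈ expSpan n (c * R) := by
  induction hF using Submodule.span_induction with
  | mem F hF =>
    obtain ⟨a, ha, rfl⟩ := hF
    refine Submodule.subset_span ⟨c • a, ?_, ?_⟩
    · rw [norm_smul, Real.norm_of_nonneg hc]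
      gcongr
    · simp only [inner_smul_left, inner_smul_right, conj_trivial]
  | zero => exact Submodule.zero_mem _
  | add F G _ _ hF hG => exact Submodule.add_mem _ hF hG
  | smul c F _ hF => exact Submodule.smul_mem _ c hF

lemma IsTrigPoly.exists_mem_expSpan {f : Rn n → ℂ} (hf : IsTrigPoly f) :
    ∃ R : ℝ, 0 ≤ R ∧ f ∈ expSpan n R := by
  refine hf.induction (P := fun f => ∃ R : ℝ, 0 ≤ R ∧ f ∈ expSpan n R) (fun k => ?_)
    ⟨0, le_rfl, Submodule.zero_mem _⟩ ?_ ?_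
  · refine ⟨‖(intVec k : Rn n)‖, norm_nonneg _, Submodule.subset_span ⟨-intVec k, ?_, ?_⟩⟩
    · rw [norm_neg]
    · ext ξ
      rw [cexpInt_eq_exp_inner, inner_neg_left]
      push_cast
      rw [mul_neg, neg_neg]
  · rintro u v ⟨R, hR, hu⟩ ⟨S, hS, hv⟩
    exact ⟨max R S, le_max_of_le_left hR, Submodule.add_mem _ (expSpan_mono (le_max_left _ _) hu)
      (expSpan_mono (le_max_right _ _) hv)⟩
  · rintro c u ⟨R, hR, hu⟩
    exact ⟨R, hR, Submodule.smul_mem _ c hu⟩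

/-- The partial products have frequencies in one and the same ball, since
`∑_{j≥1} lam^{-j} ≤ 1`. -/
lemma partialProd_mem_expSpan {lam : ℕ} (hlam : 2 ≤ lam) {τ : Rn n → ℂ} {R : ℝ} (hR : 0 ≤ R)
    (hτ : τ ∈ expSpan n R) (J : ℕ) : partialProd lam τ J ∈ expSpan n R := by
  have h2 : (2 : ℝ) ≤ lam := by exact_mod_cast hlam
  induction J with
  | zero =>
    refine Submodule.subset_span ⟨0, by simpa using hR, ?_⟩
    ext ξ
    simp [partialProd]
  | succ J ih =>
    have := comp_smul_mem_expSpan (c := (lam : ℝ)⁻¹) (by positivity) (mul_mem_expSpan hτ ih)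
    have hle : (lam : ℝ)⁻¹ * (R + R) ≤ R := by
      rw [inv_mul_le_iff₀ (by linarith)]
      nlinarith
    refine expSpan_mono hle ?_
    convert this using 1
    ext ξ
    exact partialProd_succ τ J ξ

/-- By Fourier inversion, an exponential sum with frequencies in a ball pairs with a Schwartz
function which is constant on this ball like a multiple of the evaluation at the origin. -/
lemma integral_expSpan_mul_fourierInv {R : ℝ} {F : Rn n → ℂ} (hF : F ∈ expSpan n R)
    (s : 𝓢(Rn n, ℂ)) {c : ℂ} (hs : ∀ x, ‖x‖ ≤ R → s x = c) :
    ∫ ξ, F ((2 * Real.pi) • ξ) * (𝓕⁻ s) ξ = F 0 * c := by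
  suffices h : Integrable (fun ξ => F ((2 * Real.pi) • ξ) * (𝓕⁻ s) ξ) ∧
      ∫ ξ, F ((2 * Real.pi) • ξ) * (𝓕⁻ s) ξ = F 0 * c from h.2
  induction hF using Submodule.span_induction with
  | mem F hF =>
    obtain ⟨a, ha, rfl⟩ := hF
    constructor
    · refine ((𝓕⁻ s).integrable (μ := volume)).bdd_mul (c := 1)
        (Continuous.aestronglyMeasurable (by fun_prop)) (Filter.Eventually.of_forall fun ξ => ?_)
      beta_reduce
      rw [← mul_neg, mul_comm, ← Complex.ofReal_neg, Complex.norm_exp_ofReal_mul_I]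
    · have h1 : (𝓕 (𝓕⁻ s)) a = s a := by rw [FourierTransform.fourier_fourierInv_eq]
      rw [SchwartzMap.fourier_coe, Real.fourier_eq', hs a ha] at h1
      simp only [inner_zero_right, Complex.ofReal_zero, mul_zero, neg_zero, Complex.exp_zero,
        one_mul, ← h1]
      refine integral_congr_ae (Filter.Eventually.of_forall fun ξ => ?_)
      simp only [smul_eq_mul, inner_smul_right, real_inner_comm a ξ]
      congr 2
      push_cast
      ring
  | zero => simp
  | add F G _ _ hF hG =>
    simp only [Pi.add_apply, add_mul]
    exact ⟨hF.1.add hG.1, by rw [integral_add hF.1 hG.1, hF.2, hG.2]⟩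
  | smul d F _ hF =>
    simp only [Pi.smul_apply, smul_eq_mul, mul_assoc]
    exact ⟨hF.1.const_mul d, by rw [integral_const_mul, hF.2]⟩

/-! ### The refinable function -/

/-- Integrals of the refinable function against Schwartz functions which are constant on the ball
containing the frequencies of the partial products. -/
lemma integral_refinable_mul_schwartz {lam : ℕ} (hlam : 2 ≤ lam) {τ : Rn n → ℂ}
    (hτ : IsTrigPoly τ) (h0 : τ 0 = 1) (h1 : ∀ ξ, ‖τ ξ‖ ≤ 1) {R : ℝ} (hR : 0 ≤ R)
    (hτR : τ ∈ expSpan n R) {φ : L2 n}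
    (hφ : ((𝓕 φ : L2 n) : Rn n → ℂ) =ᵐ[volume] fun ξ => phiHat lam τ ((2 * Real.pi) • ξ))
    (s : 𝓢(Rn n, ℂ)) {c : ℂ} (hs : ∀ x, ‖x‖ ≤ R → s x = c) :
    ∫ x, φ x * s x = c := by
  have h2 : ∫ x, φ x * s x = ∫ ξ, phiHat lam τ ((2 * Real.pi) • ξ) * (𝓕⁻ s) ξ := by
    have := integral_fourier_mul_schwartz φ (𝓕⁻ s)
    rw [FourierTransform.fourier_fourierInv_eq] at this
    rw [← this]
    refine integral_congr_ae ?_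
    filter_upwards [hφ] with ξ hξ
    rw [hξ]
  rw [h2]
  have hlim : Filter.Tendsto
      (fun J => ∫ ξ, partialProd lam τ J ((2 * Real.pi) • ξ) * (𝓕⁻ s) ξ) Filter.atTop
      (nhds (∫ ξ, phiHat lam τ ((2 * Real.pi) • ξ) * (𝓕⁻ s) ξ)) := by
    refine tendsto_integral_of_dominated_convergence (fun ξ => ‖(𝓕⁻ s) ξ‖) (fun J => ?_)
      ((𝓕⁻ s).integrable (μ := volume)).norm (fun J => Filter.Eventually.of_forall fun ξ => ?_)
      (Filter.Eventually.of_forall fun ξ => ?_)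
    · exact (((continuous_partialProd hτ J).comp (continuous_const_smul _)).mul
        (𝓕⁻ s).continuous).aestronglyMeasurable
    · rw [norm_mul]
      exact mul_le_of_le_one_left (norm_nonneg _) (norm_partialProd_le h1 J _)
    · exact (tendsto_partialProd hlam hτ h0 _).mul_const _
  refine tendsto_nhds_unique hlim ?_
  simp_rw [integral_expSpan_mul_fourierInv (partialProd_mem_expSpan hlam hR hτR _) s hs,
    partialProd_apply_zero h0, one_mul]
  exact tendsto_const_nhds

lemma refinable_ae_eq_zero {lam : ℕ} (hlam : 2 ≤ lam) {τ : Rn n → ℂ}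
    (hτ : IsTrigPoly τ) (h0 : τ 0 = 1) (h1 : ∀ ξ, ‖τ ξ‖ ≤ 1) {R : ℝ} (hR : 0 ≤ R)
    (hτR : τ ∈ expSpan n R) {φ : L2 n}
    (hφ : ((𝓕 φ : L2 n) : Rn n → ℂ) =ᵐ[volume] fun ξ => phiHat lam τ ((2 * Real.pi) • ξ)) :
    ∀ᵐ x : Rn n, x ∉ Metric.closedBall (0 : Rn n) R → φ x = 0 := by
  refine IsOpen.ae_eq_zero_of_integral_contDiff_smul_eq_zero
    (U := (Metric.closedBall (0 : Rn n) R)ᶜ) Metric.isClosed_closedBall.isOpen_compl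
    (((Lp.memLp φ).locallyIntegrable (by norm_num)).locallyIntegrableOn _)
    fun g hg hgc hgU => ?_
  have hg₁ : HasCompactSupport (Complex.ofRealCLM ∘ g) := hgc.comp_left rfl
  have hg₂ : ContDiff ℝ ∞ (Complex.ofRealCLM ∘ g) := by fun_prop
  have := integral_refinable_mul_schwartz hlam hτ h0 h1 hR hτR hφ (hg₁.toSchwartzMap hg₂) (c := 0)
    fun x hx => by
      have : x ∉ tsupport g := fun h => hgU h (by simpa using hx)
      simp [image_eq_zero_of_notMem_tsupport this]
  simpa [mul_comm] using this

lemma integrable_of_ae_eq_zero_off_closedBall {φ : L2 n} {R : ℝ}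
    (h : ∀ᵐ x : Rn n, x ∉ Metric.closedBall (0 : Rn n) R → φ x = 0) :
    Integrable (φ : Rn n → ℂ) := by
  have h1 : IntegrableOn (φ : Rn n → ℂ) (Metric.closedBall 0 R) :=
    ((Lp.memLp φ).locallyIntegrable (by norm_num)).integrableOn_isCompact
      (isCompact_closedBall _ _)
  exact h1.integrable_of_ae_notMem_eq_zero h

/-- The refinable function has mean value `1`. -/
lemma integral_refinable {lam : ℕ} (hlam : 2 ≤ lam) {τ : Rn n → ℂ}
    (hτ : IsTrigPoly τ) (h0 : τ 0 = 1) (h1 : ∀ ξ, ‖τ ξ‖ ≤ 1) {R : ℝ} (hR : 0 ≤ R)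
    (hτR : τ ∈ expSpan n R) {φ : L2 n}
    (hφ : ((𝓕 φ : L2 n) : Rn n → ℂ) =ᵐ[volume] fun ξ => phiHat lam τ ((2 * Real.pi) • ξ)) :
    ∫ x, φ x = 1 := by
  let b : ContDiffBump (0 : Rn n) := ⟨R + 1, R + 2, by linarith, by linarith⟩
  have hg₁ : HasCompactSupport (Complex.ofRealCLM ∘ b) := b.hasCompactSupport.comp_left rfl
  have hg₂ : ContDiff ℝ ∞ (Complex.ofRealCLM ∘ b) :=
    Complex.ofRealCLM.contDiff.comp b.contDiff
  have hb : ∀ x : Rn n, ‖x‖ ≤ R → (hg₁.toSchwartzMap hg₂) x = 1 := by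
    intro x hx
    have : b x = 1 := b.one_of_mem_closedBall (by
      rw [mem_closedBall_zero_iff]
      exact hx.trans (by change R ≤ R + 1; linarith))
    simp [this]
  rw [← integral_refinable_mul_schwartz hlam hτ h0 h1 hR hτR hφ (hg₁.toSchwartzMap hg₂) hb]
  refine integral_congr_ae ?_
  filter_upwards [refinable_ae_eq_zero hlam hτ h0 h1 hR hτR hφ] with x hx
  by_cases hxR : x ∈ Metric.closedBall (0 : Rn n) R
  · rw [hb x (by simpa using hxR), mul_one]
  · rw [hx hxR, zero_mul]

/-! ### Dilations and translations -/

lemma ae_smul {c : ℝ} (hc : c ≠ 0) {P : Rn n → Prop} (h : ∀ᵐ x, P x) : ∀ᵐ x, P (c • x) :=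
  (Measure.quasiMeasurePreserving_smul volume hc).ae h

lemma quasiMeasurePreserving_smul_sub {c : ℝ} (hc : c ≠ 0) (v : Rn n) :
    Measure.QuasiMeasurePreserving (fun x : Rn n => c • x - v) volume volume :=
  (measurePreserving_sub_right volume v).quasiMeasurePreserving.comp
    (Measure.quasiMeasurePreserving_smul volume hc)

lemma integral_comp_smul_sub {c : ℝ} (hc : 0 < c) (v : Rn n) (f : Rn n → ℂ) :
    ∫ x, f (c • x - v) = ((c ^ n)⁻¹ : ℝ) • ∫ x, f x := by
  rw [Measure.integral_comp_smul volume (fun x => f (x - v)) c, integral_sub_right_eq_self,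
    finrank_euclideanSpace_fin, abs_of_pos (by positivity)]

lemma lintegral_comp_smul_sub {c : ℝ} (hc : 0 < c) (v : Rn n) (f : Rn n → ENNReal) :
    ∫⁻ x, f (c • x - v) = ENNReal.ofReal ((c ^ n)⁻¹) * ∫⁻ x, f x := by
  have hemb : MeasurableEmbedding (fun x : Rn n => c • x) :=
    (MeasurableEquiv.smul₀ c hc.ne').measurableEmbedding
  have h1 := hemb.lintegral_map (μ := volume) (fun x => f (x - v))
  rw [← h1]
  have h2 := Measure.map_addHaar_smul (volume : Measure (Rn n)) hc.ne'
  rw [h2, lintegral_smul_measure, lintegral_sub_right_eq_self, finrank_euclideanSpace_fin,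
    abs_of_pos (by positivity), smul_eq_mul]

lemma memLp_comp_smul_sub {c : ℝ} (hc : 0 < c) (v : Rn n) {f : Rn n → ℂ} (hf : MemLp f 2) :
    MemLp (fun x => f (c • x - v)) 2 := by
  refine ⟨hf.1.comp_quasiMeasurePreserving (quasiMeasurePreserving_smul_sub hc.ne' v), ?_⟩
  have h := hf.2
  rw [eLpNorm_lt_top_iff_lintegral_rpow_enorm_lt_top (by norm_num) (by norm_num)] at h ⊢
  rw [lintegral_comp_smul_sub hc v (fun x => ‖f x‖ₑ ^ (2 : ENNReal).toReal)]
  exact ENNReal.mul_lt_top ENNReal.ofReal_lt_top h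

/-- The function `x ↦ φ(lam x - k)` as an element of `L²`. -/
noncomputable def dilShift {lam : ℕ} (hlam : 0 < lam) (k : Fin n → ℤ) (φ : L2 n) : L2 n :=
  (memLp_comp_smul_sub (c := (lam : ℝ)) (by exact_mod_cast hlam) (intVec k) (Lp.memLp φ)).toLp _

lemma dilShift_ae_eq {lam : ℕ} (hlam : 0 < lam) (k : Fin n → ℤ) (φ : L2 n) :
    dilShift hlam k φ =ᵐ[volume] fun x => φ ((lam : ℝ) • x - intVec k) :=
  MemLp.coeFn_toLp _

lemma fourier_dilShift {lam : ℕ} (hlam : 0 < lam) (k : Fin n → ℤ) (φ : L2 n) :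
    ((𝓕 (dilShift hlam k φ) : L2 n) : Rn n → ℂ) =ᵐ[volume] fun ξ =>
      ((lam : ℂ) ^ n)⁻¹ * (cexpInt (-k) ((2 * Real.pi) • (lam : ℝ)⁻¹ • ξ) *
        ((𝓕 φ : L2 n) : Rn n → ℂ) ((lam : ℝ)⁻¹ • ξ)) := by
  have hl : (0 : ℝ) < lam := by exact_mod_cast hlam
  have hlc : (lam : ℂ) ≠ 0 := by exact_mod_cast hlam.ne'
  set e : Rn n → ℂ := fun ξ => cexpInt (-k) ((2 * Real.pi) • ξ) with he
  have hec : ContDiff ℝ ∞ e := by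
    have h1 : ContDiff ℝ ∞ fun ξ : Rn n =>
        Complex.ofRealCLM (inner ℝ (intVec (-k)) ((2 * Real.pi) • ξ)) :=
      Complex.ofRealCLM.contDiff.comp (contDiff_const.inner ℝ (contDiff_const_smul _))
    simp only [he, cexpInt_eq_exp_inner]
    exact (contDiff_const.mul h1).cexp
  refine fourier_ae_eq_of_forall_integral ?_ fun s hs => ?_
  · have h1 := memLp_comp_smul_sub (c := (lam : ℝ)⁻¹) (by positivity) 0
      (Lp.memLp (𝓕 φ : L2 n))
    simp only [sub_zero] at h1
    refine (h1.of_le (f := fun ξ => cexpInt (-k) ((2 * Real.pi) • (lam : ℝ)⁻¹ • ξ) *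
        ((𝓕 φ : L2 n) : Rn n → ℂ) ((lam : ℝ)⁻¹ • ξ)) ?_
      (Filter.Eventually.of_forall fun ξ => ?_)).const_mul _
    · exact (((continuous_cexpInt (-k)).comp (by fun_prop)).aestronglyMeasurable).mul h1.1
    · rw [norm_mul, norm_cexpInt, one_mul]
  · -- the test function `η ↦ e(η) s(lam η)` has a dilated translate of `𝓕 s` as Fourier transform
    have hs'c : HasCompactSupport fun η : Rn n => e η * s ((lam : ℝ) • η) :=
      (hs.comp_smul hl.ne').mul_left
    have hs's : ContDiff ℝ ∞ fun η : Rn n => e η * s ((lam : ℝ) • η) :=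
      hec.mul ((s.smooth ⊤).comp (contDiff_const_smul _))
    have h1 := integral_fourier_mul_schwartz φ (hs'c.toSchwartzMap hs's)
    have hF : ∀ y : Rn n, (𝓕 (hs'c.toSchwartzMap hs's)) y
        = ((lam : ℂ) ^ n)⁻¹ * (𝓕 s) ((lam : ℝ)⁻¹ • (y + intVec k)) := by
      intro y
      rw [SchwartzMap.fourier_coe, SchwartzMap.fourier_coe, Real.fourier_eq', Real.fourier_eq']
      have h2 := integral_comp_smul_sub hl (0 : Rn n) (fun v =>
        Complex.exp (↑(-2 * Real.pi * inner ℝ v ((lam : ℝ)⁻¹ • (y + intVec k))) * Complex.I) • s v)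
      rw [Complex.real_smul] at h2
      push_cast at h2 ⊢
      rw [← h2]
      refine integral_congr_ae (Filter.Eventually.of_forall fun v => ?_)
      simp only [HasCompactSupport.toSchwartzMap_toFun, sub_zero, he, smul_eq_mul,
        cexpInt_eq_exp_inner]
      rw [← mul_assoc, ← Complex.exp_add]
      congr 2
      have : inner ℝ ((lam : ℝ) • v) ((lam : ℝ)⁻¹ • (y + intVec k)) = inner ℝ v y
          + inner ℝ (intVec k) v := by
        rw [inner_smul_left, inner_smul_right, inner_add_right, conj_trivial,
          mul_inv_cancel_left₀ hl.ne', real_inner_comm v]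
      have hneg : inner ℝ (intVec (-k)) ((2 * Real.pi) • v)
          = -(2 * Real.pi) * inner ℝ (intVec k) v := by
        rw [inner_smul_right, show (intVec (-k) : Rn n) = -intVec k by ext i; simp [intVec],
          inner_neg_left]
        ring
      rw [this, hneg]
      push_cast
      ring
    have hLHS : ∫ ξ, ((lam : ℂ) ^ n)⁻¹ * (cexpInt (-k) ((2 * Real.pi) • (lam : ℝ)⁻¹ • ξ) *
        ((𝓕 φ : L2 n) : Rn n → ℂ) ((lam : ℝ)⁻¹ • ξ)) * s ξ
        = ∫ ξ, ((𝓕 φ : L2 n) : Rn n → ℂ) ξ * (hs'c.toSchwartzMap hs's) ξ := by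
      have h2 := integral_comp_smul_sub hl (0 : Rn n) (fun ξ =>
        (cexpInt (-k) ((2 * Real.pi) • (lam : ℝ)⁻¹ • ξ) *
        ((𝓕 φ : L2 n) : Rn n → ℂ) ((lam : ℝ)⁻¹ • ξ)) * s ξ)
      simp only [mul_assoc ((lam : ℂ) ^ n)⁻¹]
      rw [Complex.real_smul] at h2
      push_cast at h2
      rw [integral_const_mul, ← h2]
      refine integral_congr_ae (Filter.Eventually.of_forall fun ξ => ?_)
      simp only [HasCompactSupport.toSchwartzMap_toFun, sub_zero, he, inv_smul_smul₀ hl.ne']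
      ring
    have hRHS : ∫ x, dilShift hlam k φ x * (𝓕 s) x
        = ∫ x, φ x * (𝓕 (hs'c.toSchwartzMap hs's)) x := by
      have h2 := integral_comp_smul_sub hl (intVec k) (fun y =>
        φ y * (𝓕 s) ((lam : ℝ)⁻¹ • (y + intVec k)))
      rw [Complex.real_smul] at h2
      push_cast at h2
      simp_rw [hF, mul_left_comm (φ _)]
      rw [integral_const_mul, ← h2]
      refine integral_congr_ae ?_
      filter_upwards [dilShift_ae_eq hlam k φ] with x hx
      rw [hx, sub_add_cancel, inv_smul_smul₀ hl.ne']
    rw [hLHS, hRHS, h1]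

/-- The function `x ↦ lamⁿ ∑ₘ h(m) φ(lam x - m)`. -/
noncomputable def filterL2 {lam : ℕ} (hlam : 0 < lam) (h : (Fin n → ℤ) →₀ ℂ) (φ : L2 n) : L2 n :=
  ∑ m ∈ h.support, ((lam : ℂ) ^ n * h m) • dilShift hlam m φ

lemma coeFn_sum_smul_L2 {κ : Type*} (s : Finset κ) (c : κ → ℂ) (u : κ → L2 n) :
    ((∑ i ∈ s, c i • u i : L2 n) : Rn n → ℂ) =ᵐ[volume] fun x => ∑ i ∈ s, c i * u i x := by
  classical
  induction s using Finset.induction_on with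
  | empty =>
    simp only [Finset.sum_empty]
    exact Lp.coeFn_zero ℂ 2 (volume : Measure (Rn n))
  | insert i s hi ih =>
    rw [Finset.sum_insert hi]
    filter_upwards [Lp.coeFn_add (c i • u i) (∑ i ∈ s, c i • u i), Lp.coeFn_smul (c i) (u i), ih]
      with x h1 h2 h3
    rw [h1, Pi.add_apply, h2, h3, Finset.sum_insert hi, Pi.smul_apply, smul_eq_mul]

lemma filterL2_ae_eq {lam : ℕ} (hlam : 0 < lam) (h : (Fin n → ℤ) →₀ ℂ) (φ : L2 n) :
    filterL2 hlam h φ =ᵐ[volume] fun x =>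
      (lam : ℂ) ^ n * ∑ m ∈ h.support, h m * φ ((lam : ℝ) • x - intVec m) := by
  have h1 : ∀ᵐ x : Rn n, ∀ m ∈ h.support,
      dilShift hlam m φ x = φ ((lam : ℝ) • x - intVec m) :=
    (Filter.eventually_all_finset _).mpr fun m _ => dilShift_ae_eq hlam m φ
  filter_upwards [coeFn_sum_smul_L2 h.support (fun m => (lam : ℂ) ^ n * h m)
    (fun m => dilShift hlam m φ), h1] with x hx hx1
  rw [filterL2, hx, Finset.mul_sum]
  exact Finset.sum_congr rfl fun m hm => by rw [hx1 m hm, mul_assoc]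

lemma ft_filterL2 {lam : ℕ} (hlam : 0 < lam) (h : (Fin n → ℤ) →₀ ℂ) (φ : L2 n) :
    ∀ᵐ ξ : Rn n, ft (filterL2 hlam h φ) ((lam : ℝ) • ξ)
      = (∑ m ∈ h.support, h m * cexpInt (-m) ξ) * ft φ ξ := by
  have hl : (lam : ℝ) ≠ 0 := by exact_mod_cast hlam.ne'
  have hlc : (lam : ℂ) ^ n ≠ 0 := pow_ne_zero _ (by exact_mod_cast hlam.ne')
  have hpi : (2 * Real.pi)⁻¹ ≠ 0 := inv_ne_zero (by positivity)
  have hlin : (𝓕 (filterL2 hlam h φ) : L2 n)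
      = ∑ m ∈ h.support, ((lam : ℂ) ^ n * h m) • (𝓕 (dilShift hlam m φ) : L2 n) := by
    change Lp.fourierTransformₗᵢ (Rn n) ℂ (filterL2 hlam h φ) = _
    rw [filterL2, map_sum]
    exact Finset.sum_congr rfl fun m _ => map_smul _ _ _
  have h1 : ∀ᵐ ξ : Rn n, ((𝓕 (filterL2 hlam h φ) : L2 n) : Rn n → ℂ) ξ
      = ∑ m ∈ h.support, h m * (cexpInt (-m) ((2 * Real.pi) • (lam : ℝ)⁻¹ • ξ) *
        ((𝓕 φ : L2 n) : Rn n → ℂ) ((lam : ℝ)⁻¹ • ξ)) := by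
    have h2 := (Filter.eventually_all_finset h.support).mpr fun m _ => fourier_dilShift hlam m φ
    rw [hlin]
    filter_upwards [coeFn_sum_smul_L2 h.support (fun m => (lam : ℂ) ^ n * h m)
      (fun m => (𝓕 (dilShift hlam m φ) : L2 n)), h2] with x hx hx1
    rw [hx]
    refine Finset.sum_congr rfl fun m hm => ?_
    rw [hx1 m hm]
    field_simp
  filter_upwards [ae_smul hl (ae_smul hpi h1)] with ξ hξ
  rw [ft, hξ, Finset.sum_mul]
  refine Finset.sum_congr rfl fun m _ => ?_
  have hpt : (lam : ℝ)⁻¹ • (2 * Real.pi)⁻¹ • (lam : ℝ) • ξ = (2 * Real.pi)⁻¹ • ξ := by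
    rw [smul_comm (2 * Real.pi)⁻¹, inv_smul_smul₀ hl]
  rw [hpt, smul_inv_smul₀ (by positivity), ft, mul_assoc]

/-- Elements of `L²` with the same Fourier transform agree. -/
lemma eq_of_ft_smul_ae_eq {c : ℝ} (hc : c ≠ 0) {u v : L2 n}
    (h : ∀ᵐ ξ : Rn n, ft u (c • ξ) = ft v (c • ξ)) : u = v := by
  have h1 := ae_smul (inv_ne_zero hc) h
  have h2 := ae_smul (c := 2 * Real.pi) (by positivity) h1
  have h3 : (𝓕 u : L2 n) = 𝓕 v := by
    refine Lp.ext ?_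
    filter_upwards [h2] with ξ hξ
    simpa only [ft, smul_inv_smul₀ hc, inv_smul_smul₀ Real.two_pi_pos.ne'] using hξ
  exact (Lp.fourierTransformₗᵢ (Rn n) ℂ).injective h3

lemma isCompactlySupported_filterL2 {lam : ℕ} (hlam : 0 < lam) (h : (Fin n → ℤ) →₀ ℂ) {φ : L2 n}
    {R : ℝ} (hφ : ∀ᵐ x : Rn n, x ∉ Metric.closedBall (0 : Rn n) R → φ x = 0) :
    IsCompactlySupported (filterL2 hlam h φ) := by
  have hl : (0 : ℝ) < lam := by exact_mod_cast hlam
  refine ⟨⋃ m ∈ h.support, (fun y : Rn n => (lam : ℝ)⁻¹ • (y + intVec m)) ''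
    Metric.closedBall (0 : Rn n) R, h.support.isCompact_biUnion fun m _ =>
      (isCompact_closedBall _ _).image (by fun_prop), ?_⟩
  have h1 : ∀ᵐ x : Rn n, ∀ m ∈ h.support,
      (lam : ℝ) • x - intVec m ∉ Metric.closedBall (0 : Rn n) R →
        φ ((lam : ℝ) • x - intVec m) = 0 :=
    (Filter.eventually_all_finset _).mpr fun m _ =>
      (quasiMeasurePreserving_smul_sub hl.ne' (intVec m)).ae hφ
  filter_upwards [filterL2_ae_eq hlam h φ, h1] with x hx hx1 hxK
  rw [hx, Finset.sum_eq_zero, mul_zero]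
  intro m hm
  rw [hx1 m hm, mul_zero]
  intro hmem
  refine hxK (Set.mem_biUnion hm ⟨_, hmem, ?_⟩)
  simp only [sub_add_cancel, inv_smul_smul₀ hl.ne']

end FourierSide

section Frame

open scoped ENNReal
open Filter Topology

/-! ### Wavelet coefficients -/

/-- The coefficient `⟨f, ψ_{j,k}⟩`. -/
noncomputable def waveCoeff (lam : ℕ) (j : ℤ) (k : Fin n → ℤ) (ψ f : L2 n) : ℂ :=
  ∫ x : Rn n, f x * star (dilTrans lam j k ψ x)

lemma dilWeight_sq {lam : ℕ} (hlam : 0 < lam) (j : ℤ) :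
    ((lam : ℝ) ^ ((j : ℝ) * n / 2)) ^ 2 = ((lam : ℝ) ^ j) ^ n := by
  have hl : (0 : ℝ) < lam := by exact_mod_cast hlam
  rw [← Real.rpow_natCast, ← Real.rpow_mul hl.le, ← zpow_natCast, ← zpow_mul,
    ← Real.rpow_intCast]
  congr 1
  push_cast
  ring

lemma dilWeight_succ {lam : ℕ} (hlam : 0 < lam) (j : ℤ) :
    (lam : ℝ) ^ (((j + 1 : ℤ) : ℝ) * n / 2)
      = (lam : ℝ) ^ ((j : ℝ) * n / 2) * (lam : ℝ) ^ ((n : ℝ) / 2) := by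
  have hl : (0 : ℝ) < lam := by exact_mod_cast hlam
  rw [← Real.rpow_add hl]
  congr 1
  push_cast
  ring

lemma memLp_dilTrans {lam : ℕ} (hlam : 0 < lam) (j : ℤ) (k : Fin n → ℤ) (ψ : L2 n) :
    MemLp (dilTrans lam j k ψ) 2 :=
  (memLp_comp_smul_sub (zpow_pos (by exact_mod_cast hlam) j) (intVec k) (Lp.memLp ψ)).const_mul _

lemma waveCoeff_eq_inner {lam : ℕ} (hlam : 0 < lam) (j : ℤ) (k : Fin n → ℤ) (ψ f : L2 n) :
    waveCoeff lam j k ψ f = inner ℂ ((memLp_dilTrans hlam j k ψ).toLp _) f := by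
  rw [L2.inner_def, waveCoeff]
  refine integral_congr_ae ?_
  filter_upwards [(memLp_dilTrans hlam j k ψ).coeFn_toLp] with x hx
  rw [hx, RCLike.inner_apply]
  rfl

lemma integrable_mul_star_dilTrans {lam : ℕ} (hlam : 0 < lam) (j : ℤ) (k : Fin n → ℤ)
    (ψ f : L2 n) : Integrable fun x => f x * star (dilTrans lam j k ψ x) :=
  (Lp.memLp f).integrable_mul (memLp_dilTrans hlam j k ψ).star

/-- Change of variables in an integral against `|ψ_{j,k}|²`. -/
lemma lintegral_enorm_sq_dilTrans_mul {lam : ℕ} (hlam : 0 < lam) (j : ℤ) (k : Fin n → ℤ)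
    (ψ : Rn n → ℂ) (G : Rn n → ℝ≥0∞) :
    ∫⁻ x, ‖dilTrans lam j k ψ x‖ₑ ^ 2 * G (((lam : ℝ) ^ j) • x - intVec k)
      = ∫⁻ y, ‖ψ y‖ₑ ^ 2 * G y := by
  have hl : (0 : ℝ) < lam := by exact_mod_cast hlam
  have hc : 0 < (lam : ℝ) ^ j := zpow_pos hl j
  have hw : ‖(((lam : ℝ) ^ ((j : ℝ) * n / 2) : ℝ) : ℂ)‖ₑ ^ 2
      = ENNReal.ofReal (((lam : ℝ) ^ j) ^ n) := by
    rw [← dilWeight_sq hlam, ENNReal.ofReal_pow (by positivity), ← ofReal_norm,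
      Complex.norm_real, Real.norm_of_nonneg (by positivity)]
  have h1 := lintegral_comp_smul_sub hc (intVec k) (fun y => ‖ψ y‖ₑ ^ 2 * G y)
  have h2 : ∀ x, ‖dilTrans lam j k ψ x‖ₑ ^ 2 * G (((lam : ℝ) ^ j) • x - intVec k)
      = ENNReal.ofReal (((lam : ℝ) ^ j) ^ n) * (‖ψ (((lam : ℝ) ^ j) • x - intVec k)‖ₑ ^ 2 *
        G (((lam : ℝ) ^ j) • x - intVec k)) := by
    intro x
    rw [dilTrans, enorm_mul, mul_pow, hw, mul_assoc]
  simp_rw [h2]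
  rw [lintegral_const_mul' _ _ ENNReal.ofReal_ne_top, h1, ← mul_assoc,
    ← ENNReal.ofReal_mul (by positivity), mul_inv_cancel₀ (by positivity), ENNReal.ofReal_one,
    one_mul]

/-- The Cauchy–Schwarz inequality. -/
lemma enorm_integral_mul_sq_le {f g : Rn n → ℂ} (hf : AEStronglyMeasurable f)
    (hg : AEStronglyMeasurable g) :
    ‖∫ x, f x * star (g x)‖ₑ ^ 2 ≤ (∫⁻ x, ‖f x‖ₑ ^ 2) * ∫⁻ x, ‖g x‖ₑ ^ 2 := by
  have h1 := ENNReal.lintegral_mul_le_Lp_mul_Lq (volume : Measure (Rn n))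
    Real.HolderConjugate.two_two hf.enorm hg.enorm
  have h2 : ‖∫ x, f x * star (g x)‖ₑ ≤ ∫⁻ x, ((fun x => ‖f x‖ₑ) * fun x => ‖g x‖ₑ) x := by
    refine (enorm_integral_le_lintegral_enorm _).trans (lintegral_mono fun x => ?_)
    rw [enorm_mul, Pi.mul_apply, Complex.star_def, RCLike.enorm_conj]
  have hsq : ∀ a : ℝ≥0∞, (a ^ (1 / 2 : ℝ)) ^ 2 = a := by
    intro a
    rw [← ENNReal.rpow_natCast, ← ENNReal.rpow_mul]
    norm_num
  calc ‖∫ x, f x * star (g x)‖ₑ ^ 2 ≤ _ := pow_le_pow_left' (h2.trans h1) 2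
    _ = _ := by
      rw [mul_pow, hsq, hsq]
      simp only [ENNReal.rpow_two]

lemma norm_sub_floorVec_le (x : Rn n) : ‖x - intVec (floorVec x)‖ ≤ n := by
  have h1 : ‖x - intVec (floorVec x)‖ ^ 2 ≤ ∑ _i : Fin n, (1 : ℝ) := by
    rw [EuclideanSpace.norm_sq_eq]
    refine Finset.sum_le_sum fun i _ => ?_
    have h0 : (x - intVec (floorVec x)) i = Int.fract (x i) := rfl
    rw [h0, Real.norm_of_nonneg (Int.fract_nonneg _)]
    exact pow_le_one₀ (Int.fract_nonneg _) (Int.fract_lt_one _).le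
  have h2 : (n : ℝ) ≤ (n : ℝ) ^ 2 := by exact_mod_cast Nat.le_self_pow two_ne_zero n
  simp only [Finset.sum_const, Finset.card_univ, Fintype.card_fin, nsmul_eq_mul, mul_one] at h1
  exact (sq_le_sq₀ (norm_nonneg _) (by positivity)).mp (h1.trans h2)

/-- A bound for the number of integer points in a ball of radius `R`. -/
noncomputable def latticeBound (n : ℕ) (R : ℝ) : ℝ≥0∞ :=
  volume (Metric.closedBall (0 : Rn n) (R + n))

lemma latticeBound_ne_top (R : ℝ) : latticeBound n R ≠ ⊤ :=
  measure_closedBall_lt_top.ne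

lemma tsum_indicator_le_latticeBound (R : ℝ) (y : Rn n) :
    ∑' k : Fin n → ℤ, (if ‖y - intVec k‖ ≤ R then (1 : ℝ≥0∞) else 0) ≤ latticeBound n R := by
  rw [← lintegral_comp_floorVec (fun k => if ‖y - intVec k‖ ≤ R then (1 : ℝ≥0∞) else 0),
    latticeBound, ← Measure.addHaar_closedBall_center volume y,
    ← lintegral_indicator_one measurableSet_closedBall]
  refine lintegral_mono fun z => ?_
  split_ifs with h
  · have hz : z ∈ Metric.closedBall y (R + n) := by
      rw [mem_closedBall_iff_norm']
      calc ‖y - z‖ = ‖(y - intVec (floorVec z)) - (z - intVec (floorVec z))‖ := by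
            rw [sub_sub_sub_cancel_right]
        _ ≤ _ := norm_sub_le _ _
        _ ≤ _ := add_le_add h (norm_sub_floorVec_le z)
    rw [Set.indicator_of_mem hz]
    rfl
  · exact zero_le

/-- Bessel's inequality for the integer translates of a compactly supported function. -/
lemma tsum_enorm_sq_waveCoeff_le {lam : ℕ} (hlam : 0 < lam) {φ : L2 n} {R : ℝ}
    (hφ : ∀ᵐ x : Rn n, x ∉ Metric.closedBall (0 : Rn n) R → φ x = 0) (j : ℤ) (f : L2 n) :
    ∑' k : Fin n → ℤ, ‖waveCoeff lam j k φ f‖ₑ ^ 2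
      ≤ latticeBound n R * (∫⁻ x, ‖φ x‖ₑ ^ 2) * ∫⁻ x, ‖f x‖ₑ ^ 2 := by
  classical
  have hc : (0 : ℝ) < (lam : ℝ) ^ j := zpow_pos (by exact_mod_cast hlam) j
  set A : (Fin n → ℤ) → Set (Rn n) := fun k => {x | ‖((lam : ℝ) ^ j) • x - intVec k‖ ≤ R} with hA
  have hAm : ∀ k, MeasurableSet (A k) := fun k =>
    measurableSet_le (by fun_prop) measurable_const
  have hsupp : ∀ k, ∀ᵐ x, x ∉ A k → dilTrans lam j k φ x = 0 := by
    intro k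
    filter_upwards [(quasiMeasurePreserving_smul_sub hc.ne' (intVec k)).ae hφ] with x hx hxA
    rw [dilTrans, hx (by simpa [hA] using hxA), mul_zero]
  have hone : ∀ k, ‖waveCoeff lam j k φ f‖ₑ ^ 2
      ≤ (∫⁻ x, (A k).indicator (fun x => ‖f x‖ₑ ^ 2) x) * ∫⁻ x, ‖φ x‖ₑ ^ 2 := by
    intro k
    have h1 : waveCoeff lam j k φ f
        = ∫ x, (A k).indicator (f : Rn n → ℂ) x * star (dilTrans lam j k φ x) := by
      refine integral_congr_ae ?_
      filter_upwards [hsupp k] with x hx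
      by_cases hxA : x ∈ A k
      · rw [Set.indicator_of_mem hxA]
      · rw [hx hxA, star_zero, mul_zero, mul_zero]
    have h2 := lintegral_enorm_sq_dilTrans_mul hlam j k φ (fun _ => 1)
    simp only [mul_one] at h2
    rw [h1, ← h2]
    refine (enorm_integral_mul_sq_le ((Lp.aestronglyMeasurable f).indicator (hAm k))
      (memLp_dilTrans hlam j k φ).1).trans (le_of_eq ?_)
    congr 2
    ext x
    by_cases hxA : x ∈ A k <;> simp [hxA]
  have hfm : AEMeasurable (fun x => ‖f x‖ₑ ^ 2) (volume : Measure (Rn n)) :=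
    (Lp.aestronglyMeasurable f).enorm.pow_const 2
  calc ∑' k : Fin n → ℤ, ‖waveCoeff lam j k φ f‖ₑ ^ 2
      ≤ ∑' k, (∫⁻ x, (A k).indicator (fun x => ‖f x‖ₑ ^ 2) x) * ∫⁻ x, ‖φ x‖ₑ ^ 2 :=
        ENNReal.tsum_le_tsum hone
    _ = (∫⁻ x, ∑' k, (A k).indicator (fun x => ‖f x‖ₑ ^ 2) x) * ∫⁻ x, ‖φ x‖ₑ ^ 2 := by
        rw [ENNReal.tsum_mul_right, lintegral_tsum fun k => hfm.indicator (hAm k)]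
    _ ≤ (∫⁻ x, latticeBound n R * ‖f x‖ₑ ^ 2) * ∫⁻ x, ‖φ x‖ₑ ^ 2 := by
        gcongr with x
        have : ∀ k, (A k).indicator (fun x => ‖f x‖ₑ ^ 2) x
            = (if ‖((lam : ℝ) ^ j) • x - intVec k‖ ≤ R then (1 : ℝ≥0∞) else 0) * ‖f x‖ₑ ^ 2 := by
          intro k
          simp only [hA, Set.indicator_apply, Set.mem_ofPred_eq, ite_mul, one_mul, zero_mul]
        simp_rw [this]
        rw [ENNReal.tsum_mul_right]
        gcongr
        exact tsum_indicator_le_latticeBound R _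
    _ = _ := by
        rw [lintegral_const_mul' _ _ (latticeBound_ne_top R)]
        ring

/-! ### Behaviour of the coefficients at coarse and fine scales -/

/-- At coarse scales the coefficients of a compactly supported function tend to `0`: on its
support, which after rescaling shrinks to a point, the mass of the translates of `φ` tends to
`0`. -/
lemma tendsto_tsum_waveCoeff_atBot (hn : 1 ≤ n) {lam : ℕ} (hlam : 2 ≤ lam) (φ : L2 n) {f : L2 n}
    {ρ : ℝ} (hρ : 0 ≤ ρ) (hf : ∀ᵐ x : Rn n, x ∉ Metric.closedBall (0 : Rn n) ρ → f x = 0) :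
    Tendsto (fun J : ℕ => ∑' k : Fin n → ℤ, ‖waveCoeff lam (-(J : ℤ)) k φ f‖ₑ ^ 2)
      atTop (𝓝 0) := by
  classical
  have hl : (1 : ℝ) < lam := by exact_mod_cast hlam
  have hl0 : (0 : ℝ) < lam := by linarith
  set Φ : Rn n → ℝ≥0∞ := fun y => ∑' k : Fin n → ℤ, ‖φ (y - intVec k)‖ₑ ^ 2 with hΦ
  have hφm : ∀ k : Fin n → ℤ, AEMeasurable (fun y : Rn n => ‖φ (y - intVec k)‖ₑ ^ 2) :=
    fun k => ((Lp.aestronglyMeasurable φ).comp_quasiMeasurePreserving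
      (measurePreserving_sub_right volume (intVec k)).quasiMeasurePreserving).enorm.pow_const 2
  have hφ2 : ∫⁻ y, ‖φ y‖ₑ ^ 2 ≠ ⊤ := by
    have := (Lp.memLp φ).2
    rw [eLpNorm_lt_top_iff_lintegral_rpow_enorm_lt_top (by norm_num) (by norm_num)] at this
    simpa using this.ne
  have hf2 : ∫⁻ y, ‖f y‖ₑ ^ 2 ≠ ⊤ := by
    have := (Lp.memLp f).2
    rw [eLpNorm_lt_top_iff_lintegral_rpow_enorm_lt_top (by norm_num) (by norm_num)] at this
    simpa using this.ne
  -- `Φ` is locally integrable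
  have hΦfin : ∫⁻ y in Metric.closedBall (0 : Rn n) 1, Φ y ≠ ⊤ := by
    refine ne_top_of_le_ne_top (ENNReal.mul_ne_top (latticeBound_ne_top (n := n) 1) hφ2) ?_
    rw [hΦ, lintegral_tsum fun k => (hφm k).restrict]
    have h1 : ∀ k : Fin n → ℤ, ∫⁻ y in Metric.closedBall (0 : Rn n) 1, ‖φ (y - intVec k)‖ₑ ^ 2
        = ∫⁻ y, (if ‖y - intVec (-k)‖ ≤ 1 then (1 : ℝ≥0∞) else 0) * ‖φ y‖ₑ ^ 2 := by
      intro k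
      rw [← lintegral_indicator measurableSet_closedBall,
        ← lintegral_sub_right_eq_self _ (intVec (-k))]
      refine lintegral_congr fun y => ?_
      have : y - intVec (-k) - intVec k = y := by
        rw [sub_sub, ← intVec_add, neg_add_cancel, intVec_zero, sub_zero]
      simp only [this, Set.indicator_apply, mem_closedBall_zero_iff, ite_mul, one_mul, zero_mul]
    simp_rw [h1]
    rw [← lintegral_tsum fun k => ?_, ← lintegral_const_mul' _ _ (latticeBound_ne_top 1)]
    · refine lintegral_mono fun y => ?_
      rw [ENNReal.tsum_mul_right]
      gcongr
      have hneg := (Equiv.neg (Fin n → ℤ)).tsum_eq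
        (fun k => if ‖y - intVec k‖ ≤ 1 then (1 : ℝ≥0∞) else 0)
      exact hneg.trans_le (tsum_indicator_le_latticeBound 1 y)
    · refine AEMeasurable.mul (Measurable.aemeasurable ?_)
        ((Lp.aestronglyMeasurable φ).enorm.pow_const 2)
      exact Measurable.ite (measurableSet_le (by fun_prop) measurable_const) measurable_const
        measurable_const
  set c : ℕ → ℝ := fun J => (lam : ℝ) ^ (-(J : ℤ)) with hc
  have hcpos : ∀ J, 0 < c J := fun J => zpow_pos hl0 _
  have hclim : Tendsto c atTop (𝓝 0) := by
    have := tendsto_pow_atTop_nhds_zero_of_lt_one (r := (lam : ℝ)⁻¹) (by positivity)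
      (inv_lt_one_of_one_lt₀ hl)
    refine this.congr fun J => ?_
    simp [hc]
  have hclim' : Tendsto (fun J => c J * ρ) atTop (𝓝 0) := by simpa using hclim.mul_const ρ
  have hbound : ∀ J : ℕ, ∑' k : Fin n → ℤ, ‖waveCoeff lam (-(J : ℤ)) k φ f‖ₑ ^ 2
      ≤ (∫⁻ x, ‖f x‖ₑ ^ 2) * ∫⁻ y in Metric.closedBall (0 : Rn n) (c J * ρ), Φ y := by
    intro J
    have hone : ∀ k : Fin n → ℤ, ‖waveCoeff lam (-(J : ℤ)) k φ f‖ₑ ^ 2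
        ≤ (∫⁻ x, ‖f x‖ₑ ^ 2) *
          ∫⁻ y in Metric.closedBall (0 : Rn n) (c J * ρ), ‖φ (y - intVec k)‖ₑ ^ 2 := by
      intro k
      have h1 : waveCoeff lam (-(J : ℤ)) k φ f = ∫ x, f x * star
          ((Metric.closedBall (0 : Rn n) ρ).indicator (dilTrans lam (-(J : ℤ)) k φ) x) := by
        refine integral_congr_ae ?_
        filter_upwards [hf] with x hx
        by_cases hxA : x ∈ Metric.closedBall (0 : Rn n) ρ
        · rw [Set.indicator_of_mem hxA]
        · rw [hx hxA, zero_mul, zero_mul]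
      have h2 := lintegral_enorm_sq_dilTrans_mul (n := n) (by omega : 0 < lam) (-(J : ℤ)) k φ
        (fun y => if ‖y + intVec k‖ ≤ c J * ρ then 1 else 0)
      have h3 : ∫⁻ y in Metric.closedBall (0 : Rn n) (c J * ρ), ‖φ (y - intVec k)‖ₑ ^ 2
          = ∫⁻ y, ‖φ y‖ₑ ^ 2 * (if ‖y + intVec k‖ ≤ c J * ρ then 1 else 0) := by
        rw [← lintegral_indicator measurableSet_closedBall,
          ← lintegral_sub_right_eq_self
            (fun y => ‖φ y‖ₑ ^ 2 * (if ‖y + intVec k‖ ≤ c J * ρ then 1 else 0)) (intVec k)]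
        refine lintegral_congr fun y => ?_
        simp only [sub_add_cancel, Set.indicator_apply, mem_closedBall_zero_iff, mul_ite, mul_one,
          mul_zero]
      rw [h1, h3, ← h2]
      refine (enorm_integral_mul_sq_le (Lp.aestronglyMeasurable f)
        ((memLp_dilTrans (by omega) (-(J : ℤ)) k φ).1.indicator
          measurableSet_closedBall)).trans ?_
      gcongr with x
      have hiff : ‖(lam : ℝ) ^ (-(J : ℤ)) • x - intVec k + intVec k‖ ≤ c J * ρ ↔ ‖x‖ ≤ ρ := by
        rw [sub_add_cancel, norm_smul, Real.norm_of_nonneg (hcpos J).le]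
        exact mul_le_mul_iff_right₀ (hcpos J)
      simp only [hiff, Set.indicator_apply, mem_closedBall_zero_iff]
      split_ifs <;> simp
    refine (ENNReal.tsum_le_tsum hone).trans ?_
    rw [ENNReal.tsum_mul_left, hΦ, lintegral_tsum fun k => (hφm k).restrict]
  have hvol : Tendsto (fun J => (volume.restrict (Metric.closedBall (0 : Rn n) 1))
      (Metric.closedBall (0 : Rn n) (c J * ρ))) atTop (𝓝 0) := by
    have h1 : Tendsto (fun J => ENNReal.ofReal ((c J * ρ) ^ n) *
        volume (Metric.closedBall (0 : Rn n) 1)) atTop (𝓝 0) := by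
      have h2 := ENNReal.tendsto_ofReal (hclim'.pow n)
      rw [zero_pow (by omega), ENNReal.ofReal_zero] at h2
      simpa using ENNReal.Tendsto.mul_const h2
        (Or.inr (measure_closedBall_lt_top (x := (0 : Rn n)) (r := 1)).ne)
    refine tendsto_of_tendsto_of_tendsto_of_le_of_le tendsto_const_nhds h1 (fun _ => zero_le)
      fun J => (Measure.restrict_apply_le _ _).trans (le_of_eq ?_)
    rw [Measure.addHaar_closedBall' _ _ (mul_nonneg (hcpos J).le hρ), finrank_euclideanSpace_fin]
  have hint := tendsto_setLIntegral_zero hΦfin hvol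
  have hint2 : Tendsto (fun J => (∫⁻ x, ‖f x‖ₑ ^ 2) *
      ∫⁻ y in Metric.closedBall (0 : Rn n) (c J * ρ), Φ y) atTop (𝓝 0) := by
    have h1 : Tendsto (fun J => ∫⁻ y in Metric.closedBall (0 : Rn n) (c J * ρ), Φ y)
        atTop (𝓝 0) := by
      refine hint.congr' ?_
      filter_upwards [hclim'.eventually_le_const one_pos] with J hJ
      rw [Measure.restrict_restrict measurableSet_closedBall,
        Set.inter_eq_left.mpr (Metric.closedBall_subset_closedBall hJ)]
    simpa using ENNReal.Tendsto.const_mul h1 (Or.inr hf2)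
  exact tendsto_of_tendsto_of_tendsto_of_le_of_le tendsto_const_nhds hint2 (fun _ => zero_le) hbound

/-- At fine scales the coefficients of a continuous compactly supported function are close to its
samples, so that their square sums are integrals of step functions converging to it. -/
lemma tendsto_tsum_waveCoeff_atTop {lam : ℕ} (hlam : 2 ≤ lam) {φ : L2 n} {R : ℝ}
    (hφ : ∀ᵐ x : Rn n, x ∉ Metric.closedBall (0 : Rn n) R → φ x = 0) (hφ1 : ∫ x, φ x = 1)
    {f : L2 n} {F : Rn n → ℂ} (hF : Continuous F) (hFc : HasCompactSupport F)
    (hfF : f =ᵐ[volume] F) :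
    Tendsto (fun J : ℕ => ∑' k : Fin n → ℤ, ‖waveCoeff lam (J : ℤ) k φ f‖ₑ ^ 2)
      atTop (𝓝 (∫⁻ x, ‖f x‖ₑ ^ 2)) := by
  have hl : (1 : ℝ) < lam := by exact_mod_cast hlam
  have hl0 : (0 : ℝ) < lam := by linarith
  have hφint : Integrable (φ : Rn n → ℂ) := integrable_of_ae_eq_zero_off_closedBall hφ
  obtain ⟨M, hM⟩ := hF.bounded_above_of_compact_support hFc
  obtain ⟨ρ, hρ⟩ := hFc.isCompact.isBounded.subset_closedBall (0 : Rn n)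
  have hF0 : ∀ x, ρ < ‖x‖ → F x = 0 := fun x hx =>
    image_eq_zero_of_notMem_tsupport fun h => by
      have := hρ h
      rw [mem_closedBall_zero_iff] at this
      linarith
  have hM0 : 0 ≤ M := (norm_nonneg _).trans (hM 0)
  -- the normalized coefficients `H J`, and the step functions `G J` which they define
  set H : ℕ → (Fin n → ℤ) → ℂ := fun J k =>
    ∫ y, F (((lam : ℝ) ^ J)⁻¹ • (y + intVec k)) * star (φ y) with hH
  set G : ℕ → Rn n → ℂ := fun J x => H J (floorVec ((lam : ℝ) ^ J • x)) with hG
  have hGm : ∀ J, Measurable (G J) := fun J =>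
    (measurable_of_countable (H J)).comp (measurable_floorVec.comp (measurable_const_smul _))
  have hcoeff : ∀ (J : ℕ) (k : Fin n → ℤ), ‖waveCoeff lam (J : ℤ) k φ f‖ₑ ^ 2
      = ENNReal.ofReal ((((lam : ℝ) ^ J) ^ n)⁻¹) * ‖H J k‖ₑ ^ 2 := by
    intro J k
    have hc : (0 : ℝ) < (lam : ℝ) ^ J := by positivity
    set w : ℝ := (lam : ℝ) ^ (((J : ℤ) : ℝ) * n / 2) with hw
    have hw2 : w ^ 2 = ((lam : ℝ) ^ J) ^ n := by
      rw [hw, dilWeight_sq (by omega), zpow_natCast]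
    have hw0 : 0 < w := Real.rpow_pos_of_pos hl0 _
    have h1 := integral_comp_smul_sub hc (intVec k) (fun y =>
      F (((lam : ℝ) ^ J)⁻¹ • (y + intVec k)) * star (φ y))
    have h2 : waveCoeff lam (J : ℤ) k φ f = ((w * (((lam : ℝ) ^ J) ^ n)⁻¹ : ℝ) : ℂ) * H J k := by
      rw [Complex.ofReal_mul, mul_assoc, hH, ← Complex.real_smul (x := (((lam : ℝ) ^ J) ^ n)⁻¹),
        ← h1, ← integral_const_mul, waveCoeff]
      refine integral_congr_ae ?_
      filter_upwards [hfF] with x hx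
      rw [hx, dilTrans, zpow_natCast, sub_add_cancel, inv_smul_smul₀ hc.ne', StarMul.star_mul,
        ← hw, Complex.star_def, Complex.conj_ofReal]
      ring
    rw [h2, enorm_mul, mul_pow]
    congr 1
    rw [← ofReal_norm, Complex.norm_real, Real.norm_of_nonneg (by positivity),
      ← ENNReal.ofReal_pow (by positivity)]
    congr 1
    rw [mul_pow, hw2]
    field_simp
  have hsum : ∀ J : ℕ, ∑' k : Fin n → ℤ, ‖waveCoeff lam (J : ℤ) k φ f‖ₑ ^ 2
      = ∫⁻ x, ‖G J x‖ₑ ^ 2 := by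
    intro J
    have hc : (0 : ℝ) < (lam : ℝ) ^ J := by positivity
    have h1 := lintegral_comp_smul_sub hc (0 : Rn n) (fun z => ‖H J (floorVec z)‖ₑ ^ 2)
    simp only [sub_zero] at h1
    rw [hG, h1, lintegral_comp_floorVec (fun k => ‖H J k‖ₑ ^ 2), ← ENNReal.tsum_mul_left]
    exact tsum_congr fun k => hcoeff J k
  have hc1 : ∀ J : ℕ, 1 ≤ (lam : ℝ) ^ J := fun J => one_le_pow₀ hl.le
  have hclose : ∀ (J : ℕ) (x : Rn n),
      ‖((lam : ℝ) ^ J)⁻¹ • intVec (floorVec ((lam : ℝ) ^ J • x)) - x‖ ≤ n * ((lam : ℝ) ^ J)⁻¹ := by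
    intro J x
    have hc : (0 : ℝ) < (lam : ℝ) ^ J := by positivity
    have h1 := norm_sub_floorVec_le ((lam : ℝ) ^ J • x)
    have h2 : ((lam : ℝ) ^ J)⁻¹ • intVec (floorVec ((lam : ℝ) ^ J • x)) - x
        = -(((lam : ℝ) ^ J)⁻¹ • ((lam : ℝ) ^ J • x - intVec (floorVec ((lam : ℝ) ^ J • x)))) := by
      rw [smul_sub, inv_smul_smul₀ hc.ne', neg_sub]
    rw [h2, norm_neg, norm_smul, Real.norm_of_nonneg (by positivity), mul_comm]
    gcongr
  have hinv : Tendsto (fun J : ℕ => ((lam : ℝ) ^ J)⁻¹) atTop (𝓝 0) := by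
    simpa using tendsto_pow_atTop_nhds_zero_of_lt_one (r := (lam : ℝ)⁻¹) (by positivity)
      (inv_lt_one_of_one_lt₀ hl)
  have hpoint : ∀ x, Tendsto (fun J => G J x) atTop (𝓝 (F x)) := by
    intro x
    have hlim : F x = ∫ y, F x * star (φ y) := by
      have h1 : ∫ y, star (φ y) = 1 := by
        have := integral_conj (f := (φ : Rn n → ℂ)) (μ := volume)
        rw [hφ1, map_one] at this
        exact this
      rw [integral_const_mul, h1, mul_one]
    rw [hlim]
    refine tendsto_integral_of_dominated_convergence (fun y => M * ‖φ y‖) (fun J => ?_)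
      (hφint.norm.const_mul M) (fun J => Eventually.of_forall fun y => ?_)
      (Eventually.of_forall fun y => ?_)
    · exact (Continuous.aestronglyMeasurable (by fun_prop)).mul (Lp.aestronglyMeasurable φ).star
    · rw [norm_mul, norm_star]
      gcongr
      exact hM _
    · refine Tendsto.mul_const _ ((hF.tendsto x).comp ?_)
      have h1 : Tendsto (fun J : ℕ => ((lam : ℝ) ^ J)⁻¹ • y) atTop (𝓝 0) := by
        simpa using hinv.smul_const y
      have h2 : Tendsto (fun J : ℕ => ((lam : ℝ) ^ J)⁻¹ •
          intVec (floorVec ((lam : ℝ) ^ J • x))) atTop (𝓝 x) := by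
        rw [tendsto_iff_norm_sub_tendsto_zero]
        refine squeeze_zero (fun _ => norm_nonneg _) (fun J => hclose J x) ?_
        simpa using hinv.const_mul (n : ℝ)
      simpa [smul_add] using h1.add h2
  set C : ℝ := M * ∫ y, ‖φ y‖ with hC
  have hGb : ∀ J x, ‖G J x‖ ≤ C := by
    intro J x
    rw [hC, ← integral_const_mul]
    refine norm_integral_le_of_norm_le (hφint.norm.const_mul M) (Eventually.of_forall fun y => ?_)
    rw [norm_mul, norm_star]
    gcongr
    exact hM _
  have hGsupp : ∀ J x, ρ + R + n < ‖x‖ → G J x = 0 := by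
    intro J x hx
    refine integral_eq_zero_of_ae ?_
    filter_upwards [hφ] with y hy
    by_cases hyR : y ∈ Metric.closedBall (0 : Rn n) R
    · rw [hF0, zero_mul, Pi.zero_apply]
      rw [mem_closedBall_zero_iff] at hyR
      have hi : ((lam : ℝ) ^ J)⁻¹ ≤ 1 := inv_le_one_of_one_le₀ (hc1 J)
      have hi0 : 0 ≤ ((lam : ℝ) ^ J)⁻¹ := by positivity
      have h1 := hclose J x
      have h2 : ‖((lam : ℝ) ^ J)⁻¹ • y‖ ≤ R := by
        rw [norm_smul, Real.norm_of_nonneg hi0]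
        exact (mul_le_of_le_one_left (norm_nonneg _) hi).trans hyR
      have h3 : (n : ℝ) * ((lam : ℝ) ^ J)⁻¹ ≤ n := mul_le_of_le_one_right (by positivity) hi
      set u := ((lam : ℝ) ^ J)⁻¹ • intVec (floorVec ((lam : ℝ) ^ J • x)) with hu
      have h4 : ‖x‖ ≤ ‖((lam : ℝ) ^ J)⁻¹ • y + u‖ + ‖((lam : ℝ) ^ J)⁻¹ • y‖ + ‖u - x‖ := by
        have : x = (((lam : ℝ) ^ J)⁻¹ • y + u) - ((lam : ℝ) ^ J)⁻¹ • y - (u - x) := by abel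
        calc ‖x‖ = ‖(((lam : ℝ) ^ J)⁻¹ • y + u) - ((lam : ℝ) ^ J)⁻¹ • y - (u - x)‖ := by
              rw [← this]
          _ ≤ _ := norm_sub_le _ _
          _ ≤ _ := by gcongr; exact norm_sub_le _ _
      rw [smul_add]
      linarith
    · rw [hy hyR, star_zero, mul_zero, Pi.zero_apply]
  simp_rw [hsum]
  have hff : ∫⁻ x, ‖f x‖ₑ ^ 2 = ∫⁻ x, ‖F x‖ₑ ^ 2 :=
    lintegral_congr_ae (hfF.mono fun x hx => by simp only [hx])
  rw [hff]
  refine tendsto_lintegral_of_dominated_convergence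
    ((Metric.closedBall (0 : Rn n) (ρ + R + n)).indicator fun _ => ENNReal.ofReal C ^ 2)
    (fun J => (hGm J).enorm.pow_const 2) (fun J => Eventually.of_forall fun x => ?_) ?_
    (Eventually.of_forall fun x => ?_)
  · by_cases hx : x ∈ Metric.closedBall (0 : Rn n) (ρ + R + n)
    · beta_reduce
      rw [Set.indicator_of_mem hx, ← ofReal_norm]
      gcongr
      exact hGb J x
    · beta_reduce
      rw [Set.indicator_of_notMem hx, hGsupp J x (by simpa using hx)]
      simp
  · rw [lintegral_indicator_const measurableSet_closedBall]
    exact ENNReal.mul_ne_top (ENNReal.pow_ne_top ENNReal.ofReal_ne_top)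
      measure_closedBall_lt_top.ne
  · exact ((ENNReal.continuous_pow 2).tendsto _).comp ((hpoint x).enorm)

/-! ### The analysis operators -/

lemma lintegral_enorm_sq_eq (f : L2 n) : ∫⁻ x, ‖f x‖ₑ ^ 2 = ENNReal.ofReal (‖f‖ ^ 2) := by
  rw [ENNReal.ofReal_pow (norm_nonneg _), ofReal_norm, Lp.enorm_def,
    eLpNorm_eq_lintegral_rpow_enorm_toReal (by norm_num) (by norm_num), ← ENNReal.rpow_natCast,
    ← ENNReal.rpow_mul]
  norm_num

/-- The bound for the analysis operators which Bessel's inequality yields. -/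
noncomputable def besselBound (R : ℝ) (φ : L2 n) : ℝ := (latticeBound n R).toReal * ‖φ‖ ^ 2

lemma besselBound_nonneg (R : ℝ) (φ : L2 n) : 0 ≤ besselBound R φ :=
  mul_nonneg ENNReal.toReal_nonneg (by positivity)

section Analysis

variable {lam : ℕ} (hlam : 0 < lam) {φ : L2 n} {R : ℝ}
  (hφ : ∀ᵐ x : Rn n, x ∉ Metric.closedBall (0 : Rn n) R → φ x = 0)

include hlam hφ

lemma tsum_enorm_sq_waveCoeff_le_ofReal (j : ℤ) (f : L2 n) :
    ∑' k : Fin n → ℤ, ‖waveCoeff lam j k φ f‖ₑ ^ 2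
      ≤ ENNReal.ofReal (besselBound R φ * ‖f‖ ^ 2) := by
  refine (tsum_enorm_sq_waveCoeff_le hlam hφ j f).trans (le_of_eq ?_)
  rw [lintegral_enorm_sq_eq, lintegral_enorm_sq_eq, besselBound,
    ENNReal.ofReal_mul (by positivity), ENNReal.ofReal_mul (by positivity),
    ENNReal.ofReal_toReal (latticeBound_ne_top R)]

lemma summable_norm_sq_waveCoeff (j : ℤ) (f : L2 n) :
    Summable fun k : Fin n → ℤ => ‖waveCoeff lam j k φ f‖ ^ 2 := by
  have h1 : ∑' k : Fin n → ℤ, ENNReal.ofReal (‖waveCoeff lam j k φ f‖ ^ 2) ≠ ⊤ := by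
    refine ne_top_of_le_ne_top ENNReal.ofReal_ne_top
      (le_trans (le_of_eq ?_) (tsum_enorm_sq_waveCoeff_le_ofReal hlam hφ j f))
    exact tsum_congr fun k => by rw [ENNReal.ofReal_pow (norm_nonneg _), ofReal_norm]
  have h2 := ENNReal.summable_toReal h1
  refine h2.congr fun k => ?_
  rw [ENNReal.toReal_ofReal (by positivity)]

lemma memℓp_waveCoeff (j : ℤ) (f : L2 n) :
    Memℓp (E := fun _ : Fin n → ℤ => ℂ) (fun k => waveCoeff lam j k φ f) 2 := by
  refine memℓp_gen ?_
  simpa using summable_norm_sq_waveCoeff hlam hφ j f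

/-- The analysis operator `f ↦ (⟨f, φ_{j,k}⟩)_k` from `L²(ℝⁿ)` to `ℓ²(ℤⁿ)`. -/
noncomputable def analysis (j : ℤ) : L2 n →ₗ[ℂ] lp (fun _ : Fin n → ℤ => ℂ) 2 where
  toFun f := ⟨fun k => waveCoeff lam j k φ f, memℓp_waveCoeff hlam hφ j f⟩
  map_add' f g := by
    ext k
    simp only [waveCoeff_eq_inner hlam, inner_add_right]
    rfl
  map_smul' c f := by
    ext k
    simp only [waveCoeff_eq_inner hlam, inner_smul_right]
    rfl

lemma hasSum_norm_sq_analysis (j : ℤ) (f : L2 n) :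
    HasSum (fun k : Fin n → ℤ => ‖waveCoeff lam j k φ f‖ ^ 2) (‖analysis hlam hφ j f‖ ^ 2) := by
  have h := lp.hasSum_norm (p := 2) (by norm_num) (analysis hlam hφ j f)
  simp only [ENNReal.toReal_ofNat, Real.rpow_two] at h
  exact h

lemma tsum_enorm_sq_waveCoeff_eq (j : ℤ) (f : L2 n) :
    ∑' k : Fin n → ℤ, ‖waveCoeff lam j k φ f‖ₑ ^ 2
      = ENNReal.ofReal (‖analysis hlam hφ j f‖ ^ 2) := by
  have h := hasSum_norm_sq_analysis hlam hφ j f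
  rw [← h.tsum_eq, ENNReal.ofReal_tsum_of_nonneg (fun _ => by positivity) h.summable]
  exact tsum_congr fun k => by rw [ENNReal.ofReal_pow (norm_nonneg _), ofReal_norm]

lemma norm_analysis_le (j : ℤ) (f : L2 n) :
    ‖analysis hlam hφ j f‖ ≤ √(besselBound R φ) * ‖f‖ := by
  have h := tsum_enorm_sq_waveCoeff_le_ofReal hlam hφ j f
  rw [tsum_enorm_sq_waveCoeff_eq hlam hφ, ENNReal.ofReal_le_ofReal_iff
    (mul_nonneg (besselBound_nonneg R φ) (by positivity))] at h
  refine (sq_le_sq₀ (norm_nonneg _) (by positivity)).mp ?_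
  rwa [mul_pow, Real.sq_sqrt (besselBound_nonneg R φ)]

end Analysis

/-- Continuous compactly supported functions are dense in `L²`. -/
lemma exists_continuous_compactSupport_norm_sub_lt (f : L2 n) {ε : ℝ} (hε : 0 < ε) :
    ∃ g : L2 n, ‖f - g‖ < ε ∧ ∃ G : Rn n → ℂ, Continuous G ∧ HasCompactSupport G ∧
      g =ᵐ[volume] G := by
  obtain ⟨G, hGc, hG, hGcont, hGm⟩ := (Lp.memLp f).exists_hasCompactSupport_eLpNorm_sub_le
    (by norm_num) (ε := ENNReal.ofReal (ε / 2)) (by simpa using hε)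
  refine ⟨hGm.toLp G, ?_, G, hGcont, hGc, hGm.coeFn_toLp⟩
  have h1 : f - hGm.toLp G = ((Lp.memLp f).sub hGm).toLp _ := by
    rw [MemLp.toLp_sub (Lp.memLp f) hGm, Lp.toLp_coeFn]
  rw [h1, Lp.norm_toLp]
  refine (ENNReal.toReal_mono ENNReal.ofReal_ne_top hG).trans_lt ?_
  rw [ENNReal.toReal_ofReal (by positivity)]
  linarith

/-- Convergence of the norms `‖T J f‖` for `f` in a dense set extends to all `f` if the `T J` are
uniformly bounded. -/
lemma tendsto_norm_of_dense {E F : Type*} [NormedAddCommGroup E] [NormedSpace ℂ E]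
    [NormedAddCommGroup F] [NormedSpace ℂ F] {T : ℕ → E →ₗ[ℂ] F} {C : ℝ} (hC : 0 ≤ C)
    (hT : ∀ J f, ‖T J f‖ ≤ C * ‖f‖) {N : E → ℝ} (hN : ∀ f g, |N f - N g| ≤ ‖f - g‖)
    {P : E → Prop} (hP : ∀ f, ∀ ε > 0, ∃ g, ‖f - g‖ < ε ∧ P g)
    (hlim : ∀ g, P g → Tendsto (fun J => ‖T J g‖) atTop (𝓝 (N g))) (f : E) :
    Tendsto (fun J => ‖T J f‖) atTop (𝓝 (N f)) := by
  rw [Metric.tendsto_atTop]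
  intro ε hε
  obtain ⟨g, hfg, hg⟩ := hP f (ε / (2 * (C + 1))) (by positivity)
  obtain ⟨J₀, hJ₀⟩ := Metric.tendsto_atTop.mp (hlim g hg) (ε / 2) (by positivity)
  refine ⟨J₀, fun J hJ => ?_⟩
  have h1 := hJ₀ J hJ
  rw [Real.dist_eq] at h1 ⊢
  have h2 : |‖T J f‖ - ‖T J g‖| ≤ C * ‖f - g‖ := by
    refine (abs_norm_sub_norm_le _ _).trans ?_
    rw [← map_sub]
    exact hT J _
  have h3 := hN g f
  rw [norm_sub_rev] at h3
  have h4 : (C + 1) * ‖f - g‖ < ε / 2 := by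
    calc (C + 1) * ‖f - g‖ < (C + 1) * (ε / (2 * (C + 1))) := by gcongr
      _ = ε / 2 := by field_simp
  calc |‖T J f‖ - N f|
      = |(‖T J f‖ - ‖T J g‖) + (‖T J g‖ - N g) + (N g - N f)| := by ring_nf
    _ ≤ |‖T J f‖ - ‖T J g‖| + |‖T J g‖ - N g| + |N g - N f| := abs_add_three _ _ _
    _ < ε := by linarith

lemma tendsto_norm_analysis_of_tendsto_tsum {lam : ℕ} (hlam : 0 < lam) {φ : L2 n} {R : ℝ}
    (hφ : ∀ᵐ x : Rn n, x ∉ Metric.closedBall (0 : Rn n) R → φ x = 0) {j : ℕ → ℤ} {f : L2 n}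
    {a : ℝ} (ha : 0 ≤ a)
    (h : Tendsto (fun J => ∑' k : Fin n → ℤ, ‖waveCoeff lam (j J) k φ f‖ₑ ^ 2) atTop
      (𝓝 (ENNReal.ofReal (a ^ 2)))) :
    Tendsto (fun J => ‖analysis hlam hφ (j J) f‖) atTop (𝓝 a) := by
  simp_rw [tsum_enorm_sq_waveCoeff_eq hlam hφ] at h
  have h1 := (ENNReal.tendsto_toReal ENNReal.ofReal_ne_top).comp h
  have h2 := (Real.continuous_sqrt.tendsto _).comp h1
  simp only [Function.comp_def, ENNReal.toReal_ofReal (sq_nonneg _), Real.sqrt_sq ha,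
    Real.sqrt_sq (norm_nonneg _)] at h2
  exact h2

lemma tendsto_norm_analysis_atTop {lam : ℕ} (hlam : 2 ≤ lam) {φ : L2 n} {R : ℝ}
    (hφ : ∀ᵐ x : Rn n, x ∉ Metric.closedBall (0 : Rn n) R → φ x = 0) (hφ1 : ∫ x, φ x = 1)
    (f : L2 n) :
    Tendsto (fun J : ℕ => ‖analysis (by omega : 0 < lam) hφ (J : ℤ) f‖) atTop (𝓝 ‖f‖) := by
  refine tendsto_norm_of_dense (Real.sqrt_nonneg _)
    (fun J f => norm_analysis_le (by omega) hφ (J : ℤ) f) (fun f g => abs_norm_sub_norm_le f g)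
    (fun f ε hε => exists_continuous_compactSupport_norm_sub_lt f hε) ?_ f
  rintro g ⟨G, hG, hGc, hgG⟩
  refine tendsto_norm_analysis_of_tendsto_tsum _ hφ (norm_nonneg g) ?_
  rw [← lintegral_enorm_sq_eq]
  exact tendsto_tsum_waveCoeff_atTop hlam hφ hφ1 hG hGc hgG

lemma tendsto_norm_analysis_atBot (hn : 1 ≤ n) {lam : ℕ} (hlam : 2 ≤ lam) {φ : L2 n} {R : ℝ}
    (hφ : ∀ᵐ x : Rn n, x ∉ Metric.closedBall (0 : Rn n) R → φ x = 0) (f : L2 n) :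
    Tendsto (fun J : ℕ => ‖analysis (by omega : 0 < lam) hφ (-(J : ℤ)) f‖) atTop (𝓝 0) := by
  refine tendsto_norm_of_dense (N := fun _ => 0) (Real.sqrt_nonneg _)
    (fun J f => norm_analysis_le (by omega) hφ (-(J : ℤ)) f) (fun f g => by simp)
    (fun f ε hε => exists_continuous_compactSupport_norm_sub_lt f hε) ?_ f
  rintro g ⟨G, hG, hGc, hgG⟩
  refine tendsto_norm_analysis_of_tendsto_tsum _ hφ le_rfl ?_
  obtain ⟨ρ, hρ⟩ := hGc.isCompact.isBounded.subset_closedBall (0 : Rn n)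
  have hg : ∀ᵐ x : Rn n, x ∉ Metric.closedBall (0 : Rn n) (max ρ 0) → g x = 0 := by
    filter_upwards [hgG] with x hx hxρ
    rw [hx]
    exact image_eq_zero_of_notMem_tsupport fun h =>
      hxρ (Metric.closedBall_subset_closedBall (le_max_left _ _) (hρ h))
  simpa using tendsto_tsum_waveCoeff_atBot hn hlam φ (le_max_right ρ 0) hg

/-! ### The tight frame identity -/

/-- The two-scale relation for the coefficients. -/
lemma waveCoeff_filterL2 {lam : ℕ} (hlam : 0 < lam) (h : (Fin n → ℤ) →₀ ℂ) (φ f : L2 n) (j : ℤ)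
    (k : Fin n → ℤ) :
    waveCoeff lam j k (filterL2 hlam h φ) f = (((lam : ℝ) ^ ((n : ℝ) / 2) : ℝ) : ℂ) *
      ∑ m ∈ h.support, star (h m) * waveCoeff lam (j + 1) ((lam : ℤ) • k + m) φ f := by
  have hl : (0 : ℝ) < lam := by exact_mod_cast hlam
  have hc : (0 : ℝ) < (lam : ℝ) ^ j := zpow_pos hl j
  set σ : ℝ := (lam : ℝ) ^ ((n : ℝ) / 2) with hσ
  have hσ2 : (σ : ℂ) * σ = (lam : ℂ) ^ n := by
    rw [← Complex.ofReal_mul, hσ, ← Real.rpow_add hl, add_halves, Real.rpow_natCast]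
    push_cast
    rfl
  have hpt : ∀ᵐ x, dilTrans lam j k (filterL2 hlam h φ) x
      = ∑ m ∈ h.support, (σ : ℂ) * h m * dilTrans lam (j + 1) ((lam : ℤ) • k + m) φ x := by
    filter_upwards [(quasiMeasurePreserving_smul_sub hc.ne' (intVec k)).ae
      (filterL2_ae_eq hlam h φ)] with x hx
    rw [dilTrans, hx, Finset.mul_sum, Finset.mul_sum]
    refine Finset.sum_congr rfl fun m _ => ?_
    have harg : (lam : ℝ) • ((lam : ℝ) ^ j • x - intVec k) - intVec m
        = (lam : ℝ) ^ (j + 1) • x - intVec ((lam : ℤ) • k + m) := by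
      rw [intVec_add, intVec_natCast_smul, zpow_add_one₀ hl.ne', smul_sub, smul_smul,
        mul_comm (lam : ℝ), sub_sub]
    rw [dilTrans, dilWeight_succ hlam, ← hσ, harg, Complex.ofReal_mul, ← hσ2]
    ring
  have h1 : waveCoeff lam j k (filterL2 hlam h φ) f = ∫ x, ∑ m ∈ h.support,
      (σ : ℂ) * star (h m) * (f x * star (dilTrans lam (j + 1) ((lam : ℤ) • k + m) φ x)) := by
    refine integral_congr_ae ?_
    filter_upwards [hpt] with x hx
    rw [hx, star_sum, Finset.mul_sum]
    refine Finset.sum_congr rfl fun m _ => ?_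
    simp only [StarMul.star_mul, Complex.star_def, Complex.conj_ofReal]
    ring
  rw [h1, integral_finsetSum _ fun m _ => (integrable_mul_star_dilTrans hlam _ _ φ f).const_mul _,
    Finset.mul_sum]
  refine Finset.sum_congr rfl fun m _ => ?_
  rw [integral_const_mul, waveCoeff, mul_assoc]

/-- One step of the decomposition: the coefficients at scale `j` with respect to all filtered
functions carry the same energy as the coefficients of `φ` at scale `j + 1`. -/
lemma hasSum_norm_sq_waveCoeff_filterL2 {κ : Type*} [Fintype κ] {lam : ℕ} (hlam : 0 < lam)
    {h : κ → (Fin n → ℤ) →₀ ℂ} {q : κ → Rn n → ℂ}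
    (hq : ∀ o ξ, q o ξ = ∑ k ∈ (h o).support, h o k * cexpInt (-k) ξ)
    (huep : ∀ ξ, ∀ μ ∈ digits lam n,
      ∑ o, q o ξ * star (q o (ξ + (2 * Real.pi / lam) • intVec μ)) = if μ = 0 then 1 else 0)
    (φ f : L2 n) (j : ℤ) {S : ℝ}
    (hS : HasSum (fun k : Fin n → ℤ => ‖waveCoeff lam (j + 1) k φ f‖ ^ 2) S) :
    HasSum (fun k : Fin n → ℤ => ∑ o, ‖waveCoeff lam j k (filterL2 hlam (h o) φ) f‖ ^ 2) S := by
  have hl : (0 : ℝ) < lam := by exact_mod_cast hlam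
  have h1 := (hasSum_norm_sq_filter hlam hq huep hS).mul_left ((lam : ℝ) ^ n)
  rw [mul_inv_cancel_left₀ (by positivity)] at h1
  suffices heq : ∀ k : Fin n → ℤ, ∑ o, ‖waveCoeff lam j k (filterL2 hlam (h o) φ) f‖ ^ 2
      = (lam : ℝ) ^ n * ∑ o, ‖∑ m ∈ (h o).support,
        star (h o m) * waveCoeff lam (j + 1) ((lam : ℤ) • k + m) φ f‖ ^ 2 by
    simp_rw [heq]
    exact h1
  intro k
  rw [Finset.mul_sum]
  refine Finset.sum_congr rfl fun o _ => ?_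
  rw [waveCoeff_filterL2, norm_mul, mul_pow, Complex.norm_real, Real.norm_of_nonneg (by positivity),
    ← Real.rpow_natCast, ← Real.rpow_mul hl.le]
  simp

/-- A telescoping series over `ℤ`. -/
lemma hasSum_int_telescope {S : ℤ → ℝ} (hmono : ∀ j, S j ≤ S (j + 1)) {a : ℝ}
    (htop : Tendsto (fun J : ℕ => S J) atTop (𝓝 a))
    (hbot : Tendsto (fun J : ℕ => S (-(J : ℤ))) atTop (𝓝 0)) :
    HasSum (fun j : ℤ => S (j + 1) - S j) a := by
  have h1 : HasSum (fun j : ℕ => S ((j : ℤ) + 1) - S j) (a - S 0) := by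
    rw [hasSum_iff_tendsto_nat_of_nonneg fun j => sub_nonneg.mpr (hmono j)]
    refine (htop.sub_const (S 0)).congr fun J => ?_
    have := Finset.sum_range_sub (fun j : ℕ => S (j : ℤ)) J
    push_cast at this
    exact this.symm
  have h2 : HasSum (fun j : ℕ => S (-((j : ℤ) + 1) + 1) - S (-((j : ℤ) + 1))) (S 0) := by
    rw [hasSum_iff_tendsto_nat_of_nonneg fun j => sub_nonneg.mpr (hmono _)]
    have h3 := hbot.const_sub (S 0)
    rw [sub_zero] at h3
    refine h3.congr fun J => ?_
    have := Finset.sum_range_sub' (fun j : ℕ => S (-(j : ℤ))) J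
    push_cast at this
    rw [neg_zero] at this
    rw [← this]
    refine Finset.sum_congr rfl fun j _ => ?_
    congr 2
    ring
  have h3 := HasSum.of_nat_of_neg_add_one (f := fun j : ℤ => S (j + 1) - S j) h1 h2
  rwa [sub_add_cancel] at h3

lemma hasSum_prod_of_nonneg {α β : Type*} {F : α × β → ℝ} (hF : ∀ x, 0 ≤ F x) {g : α → ℝ} {a : ℝ}
    (h1 : ∀ x, HasSum (fun y => F (x, y)) (g x)) (h2 : HasSum g a) : HasSum F a := by
  have hs : Summable F := (summable_prod_of_nonneg hF).mpr
    ⟨fun x => (h1 x).summable, h2.summable.congr fun x => (h1 x).tsum_eq.symm⟩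
  rw [← (hs.hasSum.prod_fiberwise h1).unique h2]
  exact hs.hasSum

/-- The functions obtained from a compactly supported refinable function of mean value `1` by the
wavelet masks generate a tight frame: the energies at successive scales telescope. -/
lemma isTightFrame_filterL2 (hn : 1 ≤ n) {lam : ℕ} (hlam : 2 ≤ lam) {ι : Type} [Fintype ι]
    {τ : Rn n → ℂ} {q : ι → Rn n → ℂ} (hU : UEP lam τ q)
    {h : Option ι → (Fin n → ℤ) →₀ ℂ}
    (hh : ∀ o ξ, allMasks τ q o ξ = ∑ k ∈ (h o).support, h o k * cexpInt (-k) ξ) {φ : L2 n} {R : ℝ}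
    (hφ : ∀ᵐ x : Rn n, x ∉ Metric.closedBall (0 : Rn n) R → φ x = 0) (hφ1 : ∫ x, φ x = 1)
    (hlam0 : 0 < lam) (href : filterL2 hlam0 (h none) φ = φ) :
    IsTightFrame lam fun i => filterL2 hlam0 (h (some i)) φ := by
  intro f
  have huep : ∀ ξ, ∀ μ ∈ digits lam n, ∑ o, allMasks τ q o ξ *
      star (allMasks τ q o (ξ + (2 * Real.pi / lam) • intVec μ)) = if μ = 0 then 1 else 0 := by
    intro ξ μ hμ
    rw [Fintype.sum_option]
    exact hU ξ μ hμ
  set S : ℤ → ℝ := fun j => ‖analysis hlam0 hφ j f‖ ^ 2 with hS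
  have hphi : ∀ j, HasSum (fun k : Fin n → ℤ => ‖waveCoeff lam j k φ f‖ ^ 2) (S j) := fun j =>
    hasSum_norm_sq_analysis hlam0 hφ j f
  have hpsi : ∀ j, HasSum (fun k : Fin n → ℤ =>
      ∑ i, ‖waveCoeff lam j k (filterL2 hlam0 (h (some i)) φ) f‖ ^ 2) (S (j + 1) - S j) := by
    intro j
    have h1 := (hasSum_norm_sq_waveCoeff_filterL2 hlam0 hh huep φ f j (hphi (j + 1))).sub (hphi j)
    simp only [Fintype.sum_option, href, add_sub_cancel_left] at h1
    exact h1
  have hmono : ∀ j, S j ≤ S (j + 1) := fun j =>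
    sub_nonneg.mp ((hpsi j).nonneg fun k => by positivity)
  have htotal : HasSum (fun j : ℤ => S (j + 1) - S j) (‖f‖ ^ 2) := by
    refine hasSum_int_telescope hmono ((tendsto_norm_analysis_atTop hlam hφ hφ1 f).pow 2) ?_
    simpa using (tendsto_norm_analysis_atBot hn hlam hφ f).pow 2
  have h2 : HasSum (fun b : ℤ × (Fin n → ℤ) =>
      ∑ i, ‖waveCoeff lam b.1 b.2 (filterL2 hlam0 (h (some i)) φ) f‖ ^ 2) (‖f‖ ^ 2) :=
    hasSum_prod_of_nonneg (fun b => by positivity) hpsi htotal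
  have h3 : HasSum (fun c : (ℤ × (Fin n → ℤ)) × ι =>
      ‖waveCoeff lam c.1.1 c.1.2 (filterL2 hlam0 (h (some c.2)) φ) f‖ ^ 2) (‖f‖ ^ 2) :=
    hasSum_prod_of_nonneg (fun c => by positivity) (fun b => hasSum_fintype _) h2
  exact (Equiv.prodComm ι (ℤ × (Fin n → ℤ))).hasSum_iff (f := fun c : (ℤ × (Fin n → ℤ)) × ι =>
      ‖waveCoeff lam c.1.1 c.1.2 (filterL2 hlam0 (h (some c.2)) φ) f‖ ^ 2) |>.mpr h3

/-- The unitary extension principle for trigonometric polynomials. -/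
theorem isCombinedMRAMask_and_exists_isTightFrame (hn : 1 ≤ n) {lam : ℕ} (hlam : 2 ≤ lam)
    {ι : Type} [Fintype ι] {τ : Rn n → ℂ} {q : ι → Rn n → ℂ} (hτ : IsTrigPoly τ)
    (hq : ∀ i, IsTrigPoly (q i)) (h0 : τ 0 = 1) (hU : UEP lam τ q) :
    IsCombinedMRAMask lam τ q ∧ ∃ ψ : ι → L2 n,
      AreMotherWavelets lam τ q ψ ∧ (∀ i, IsCompactlySupported (ψ i)) ∧ IsTightFrame lam ψ := by
  have hlam0 : 0 < lam := by omega
  have hl : (lam : ℝ) ≠ 0 := by exact_mod_cast hlam0.ne'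
  have hpi : (2 * Real.pi)⁻¹ ≠ 0 := inv_ne_zero (by positivity)
  have h1 := fun ξ => hU.norm_le_one hlam0 hτ hq ξ
  have hmem := memLp_phiHat hlam hτ h0 (hU.sum_digits_norm_sq_le hlam0 hτ hq)
  set φ : L2 n := 𝓕⁻ (hmem.toLp _) with hφdef
  have hφ : ((𝓕 φ : L2 n) : Rn n → ℂ) =ᵐ[volume] fun ξ => phiHat lam τ ((2 * Real.pi) • ξ) := by
    rw [hφdef, FourierTransform.fourier_fourierInv_eq]
    exact hmem.coeFn_toLp
  have hft : ∀ᵐ ξ : Rn n, ft φ ξ = phiHat lam τ ξ := by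
    filter_upwards [ae_smul hpi hφ] with ξ hξ
    rw [ft, hξ, smul_inv_smul₀ Real.two_pi_pos.ne']
  have hPhi : IsPhi lam τ φ := by
    filter_upwards [hft] with ξ hξ
    rw [hξ]
    exact hasProd_phiHat hlam hτ h0 ξ
  have hRef : IsRefinable lam τ φ := by
    filter_upwards [hft, ae_smul hl hft] with ξ hξ hξ'
    rw [hξ, hξ', phiHat_smul hlam hτ h0]
  obtain ⟨R, hR, hτR⟩ := hτ.exists_mem_expSpan
  have hsupp := refinable_ae_eq_zero hlam hτ h0 h1 hR hτR hφ
  have hmean := integral_refinable hlam hτ h0 h1 hR hτR hφ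
  choose h hh using isTrigPoly_allMasks hτ hq
  have href : filterL2 hlam0 (h none) φ = φ := by
    refine eq_of_ft_smul_ae_eq hl ?_
    filter_upwards [ft_filterL2 hlam0 (h none) φ, hRef] with ξ hξ hξ'
    rw [hξ, hξ', ← hh none ξ]
    rfl
  refine ⟨⟨hτ, h0, hq, ⟨φ, hPhi, hRef⟩, hU⟩, fun i => filterL2 hlam0 (h (some i)) φ,
    ⟨φ, hPhi, fun i => ?_⟩, fun i => isCompactlySupported_filterL2 hlam0 _ hsupp,
    isTightFrame_filterL2 hn hlam hU hh hsupp hmean hlam0 href⟩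
  filter_upwards [ft_filterL2 hlam0 (h (some i)) φ] with ξ hξ
  rw [hξ, ← hh (some i) ξ]
  rfl

end Frame

end TWF

theorem theorem3p1 {n lam N : ℕ} (hn : 1 ≤ n) (hlam : 2 ≤ lam) (hN : N ≤ lam ^ n)
    (ν : Fin (lam ^ n) → Fin n → ℤ) (hν : Function.Injective ν)
    (hν_mem : ∀ l, ν l ∈ TWF.digits lam n)
    (r : Fin N → ℕ)
    (p : Fin (lam ^ n) → TWF.Rn n → ℂ) (hp : ∀ l, TWF.IsTrigPoly (p l))
    (g : (l : Fin N) → Fin (r l) → TWF.Rn n → ℂ) (hg : ∀ l s, TWF.IsTrigPoly (g l s))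
    (hpg : ∀ (l : Fin N) (ξ : TWF.Rn n),
      1 - ‖p (Fin.castLE hN l) ξ‖ ^ 2 = (lam : ℝ) ^ n * ∑ s, ‖g l s ξ‖ ^ 2)
    (hp_zero : ∀ l : Fin N, p (Fin.castLE hN l) 0 = 1)
    (hp_rest : ∀ l : Fin (lam ^ n), N ≤ (l : ℕ) → ∀ ξ, ‖p l ξ‖ ^ 2 = 1)
    (hτ_zero : TWF.refMask lam ν p 0 = 1) :
    TWF.IsCombinedMRAMask lam (TWF.refMask lam ν p) (TWF.waveletMask lam ν p g) ∧
    ∃ ψ : ((l : Fin N) × Fin (r l)) ⊕ Fin (lam ^ n) → TWF.L2 n,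
      TWF.AreMotherWavelets lam (TWF.refMask lam ν p) (TWF.waveletMask lam ν p g) ψ ∧
      (∀ i, TWF.IsCompactlySupported (ψ i)) ∧
      TWF.IsTightFrame lam ψ :=
  TWF.isCombinedMRAMask_and_exists_isTightFrame hn hlam (TWF.isTrigPoly_refMask hp)
    (TWF.isTrigPoly_waveletMask hp hg) hτ_zero
    (TWF.uep_waveletMask (by omega) hN hν hν_mem hp hg hpg hp_rest)
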